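/- For positive integers $a,b,c$, consider the equiangular hexagon with side lengths $a,b,c,a,b,c$ in clockwise order, starting with the upper left side, the sides of length $b$ being horizontal, and its tilings by lozenges (unit rhombuses with angles $\pi/3$ and $2\pi/3$, each the union of two unit triangles of the triangular lattice). A lozenge is called vertical if its major axis is vertical. Number the horizontal lattice lines through the hexagon from the top, the top edge being line $0$. The hexagonal position of a vertical lozenge bisected by the $k$-th line is the horizontal distance from its right corner to the left border of the hexagon. Assume $0 \le k \le (a+c)/2$, and put $$\ell = \min(k,a,c),\qquad n = b+\ell,\qquad \rho_L = \frac{|a-k|}{n},\qquad \rho_R = \frac{|c-k|}{n}.$$ For integers $1 \le a_1 < \dots < a_\ell \le n$, let $T_{a,b,c,k}(a_1,\dots,a_\ell)$ be the number of lozenge tilings of the hexagon whose vertical lozenges on the $k$-th line occur at the hexagonal positions $a_1,\dots,a_\ell$ and nowhere else. Let $A$ be the function with $A(i/n) = \#\{j : a_j \le i\}/n$ for $0 \le i \le n$, interpolated linearly between these points, with $A(t)=0$ for $t<0$ and $A(t)=\ell/n$ for $t>1$. Write $$\langle f,g\rangle = \int_{-\infty}^{\infty}\int_{-\infty}^{\infty}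 f'(x)\,g'(y)\,\log|x-y|\,dx\,dy .$$ Proposition 3.1. There is a continuous function $K:\mathbb{R}^3\to\mathbb{R}$ such that for every $M$ and every $\varepsilon>0$ there is an $N$ with the following property. For all $a,b,c,k$ as above with $n \ge N$, $\rho_L \le M$ and $\rho_R \le M$, for all positions $1 \le a_1<\dots<a_\ell\le n$, and for every continuous function $J:\mathbb{R}\to\mathbb{R}$ whose derivative is, almost everywhere, half the characteristic function of $[-\rho_L,0]\cup[1,1+\rho_R]$, $$\left|\frac{\log T_{a,b,c,k}(a_1,\dots,a_\ell)}{n^2} - \langle A+J,A+J\rangle - K\!\left(\frac an,\frac cn,\frac kn\right)\right| \le \varepsilon .$$ In other words, $n^{-2}\log T_{a,b,c,k}(a_1,\dots,a_\ell) = \langle A+J,A+J\rangle + \text{constant} + o(1)$ as $n\to\infty$ with $\rho_L,\rho_R$ bounded, uniformly in the positions; the constant does not depend on the positions, and it converges whenever the ratios $a/n$, $c/n$, $k/n$ converge. -/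

import Mathlib

namespace LozengeTiling

/-!
The triangular lattice.  A pair `(i, r)` of integers stands for the lattice point
`i * (1, 0) + r * (-1/2, -√3/2)` of the plane: `r` numbers the horizontal lattice lines from top to
bottom, and on each line `i` increases by one per unit of length to the right.  So the lower left
neighbour of `(i, r)` is `(i, r + 1)` and its lower right neighbour is `(i + 1, r + 1)`.
-/

/-- The unit triangles of the lattice.  `up i r` has its apex at `(i, r)` and its horizontal edge on
line `r + 1`; `down i r` has its horizontal edge on line `r`, starting at `(i, r)`. -/
inductive Triangle
  | up (i r : ℤ)
  | down (i r : ℤ)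

/-- The three corners of a unit triangle. -/
def Triangle.vertices : Triangle → Set (ℤ × ℤ)
  | .up i r => {(i, r), (i, r + 1), (i + 1, r + 1)}
  | .down i r => {(i, r), (i + 1, r), (i + 1, r + 1)}

/-- The lattice points of the hexagon with sides `a, b, c, a, b, c` in clockwise order, starting
with the upper left side, the sides of length `b` being horizontal.  The top left corner is `(0, 0)`;
the other corners are, in clockwise order, `(b, 0)`, `(b + c, c)`, `(b + c, a + c)`, `(c, a + c)`,
`(0, a)`. -/
def hexagonPoints (a b c : ℕ) : Set (ℤ × ℤ) :=
  {p | 0 ≤ p.2 ∧ p.2 ≤ a + c ∧ 0 ≤ p.1 ∧ p.1 ≤ b + c ∧ -(a : ℤ) ≤ p.1 - p.2 ∧ p.1 - p.2 ≤ b}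

/-- The unit triangles of which the hexagon is the union. -/
def hexagon (a b c : ℕ) : Set Triangle :=
  {t | t.vertices ⊆ hexagonPoints a b c}

/-- The lozenges: unions of two unit triangles with a common edge, in the three orientations.
* `vertical i r`: the common edge is the horizontal one from `(i, r)` to `(i + 1, r)`, so that the
  major axis is vertical, the lozenge is bisected by line `r`, and its right corner is `(i + 1, r)`;
* `left i r`: the common edge joins `(i, r)` and `(i, r + 1)`;
* `right i r`: the common edge joins `(i, r)` and `(i + 1, r + 1)`. -/
inductive Lozenge
  | vertical (i r : ℤ)
  | left (i r : ℤ)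
  | right (i r : ℤ)

/-- The two unit triangles that make up a lozenge. -/
def Lozenge.triangles : Lozenge → Set Triangle
  | .vertical i r => {.up i (r - 1), .down i r}
  | .left i r => {.up i r, .down (i - 1) r}
  | .right i r => {.up i r, .down i r}

/-- `T` is the set of lozenges of a tiling of the `a, b, c` hexagon: the lozenges lie in the hexagon,
and each unit triangle of the hexagon is covered exactly once. -/
structure IsTiling (a b c : ℕ) (T : Set Lozenge) : Prop where
  inside : ∀ L ∈ T, L.triangles ⊆ hexagon a b c
  covered_once : ∀ t ∈ hexagon a b c, ∃! L, L ∈ T ∧ t ∈ L.triangles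

/-- The first coordinate of the leftmost point of the hexagon on the `k`-th line from the top. -/
def leftBorder (a k : ℕ) : ℤ := max 0 ((k : ℤ) - a)

/-- The hexagonal positions of the vertical lozenges of `T` that are bisected by the `k`-th line,
where the hexagonal position of such a lozenge is the horizontal distance from its right corner to
the left border of the hexagon. -/
def positions (a k : ℕ) (T : Set Lozenge) : Set ℤ :=
  {p | ∃ i : ℤ, Lozenge.vertical i k ∈ T ∧ p = (i + 1) - leftBorder a k}

/-- The number of tilings of the `a, b, c` hexagon in which the vertical lozenges on the `k`-th line
occur at the hexagonal positions in `S` and nowhere else. -/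
noncomputable def numTilings (a b c k : ℕ) (S : Finset ℤ) : ℕ :=
  {T : Set Lozenge | IsTiling a b c T ∧ positions a k T = ↑S}.ncard

/-- The number of elements of `S` that are at most `i`. -/
def countUpTo (S : Finset ℤ) (i : ℤ) : ℕ := (S.filter (fun s => s ≤ i)).card

/-- The function that interpolates linearly between the values `#{s ∈ S | s ≤ i} / n` at the points
`i / n`, for all integers `i`.  For `S ⊆ {1, …, n}` it is `0` to the left of `0` and constant to the
right of `1`. -/
noncomputable def normalizedCount (n : ℕ) (S : Finset ℤ) (t : ℝ) : ℝ :=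
  ((countUpTo S ⌊n * t⌋ : ℝ)
    + Int.fract (n * t) * ((countUpTo S (⌊n * t⌋ + 1) : ℝ) - countUpTo S ⌊n * t⌋)) / n

/-- The bilinear form `⟨f, g⟩ = ∬ f'(x) g'(y) log |x - y| dx dy`. -/
noncomputable def inprod (f g : ℝ → ℝ) : ℝ :=
  ∫ x : ℝ, ∫ y : ℝ, deriv f x * deriv g y * Real.log |x - y|

/-- `J` is a continuous function whose derivative is (off a null set, where it need not exist) half
the characteristic function of `[-ρL, 0] ∪ [1, 1 + ρR]`. -/
def IsHalfRamp (ρL ρR : ℝ) (J : ℝ → ℝ) : Prop :=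
  Continuous J ∧ ∀ᵐ x : ℝ,
    HasDerivAt J ((Set.Icc (-ρL) 0 ∪ Set.Icc 1 (1 + ρR)).indicator (fun _ => (1 / 2 : ℝ)) x) x

end LozengeTiling

/-!
Fix a tiling and look at the unit edges of the `r`-th horizontal line that do not bisect a vertical
lozenge.  There are `b` of them on each line.  The left and right lozenges between two lines match
the `j`-th such edge of the upper line with the `j`-th one of the lower line, which is at the same
first coordinate or one further.  So tilings are chains of configurations of `b` particles, each of
which stays or jumps by one in each step (`chainOfTiling`, `tilingOfChain`), and the condition on
the positions prescribes the configuration on line `k`.  The number of tilings is therefore the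
product of the numbers of chains above and below line `k`; a reflection makes both start from `b`
adjacent particles (`numTilings_eq_mul`).

For such chains, the sets of sites *not* occupied interlace, hence are the rows of a Gelfand-Tsetlin
pattern.  The number of patterns with bottom row `p` is the determinant of the binomial coefficients
`(p i).choose j`, since summing this determinant over interlacing rows gives the next larger one
(`sum_binomDet_interlacing`); and it is the Vandermonde product of `p` divided by that of
`0, 1, 2, …`.  Thus `log T` is a sum of logarithmic energies (`log_numTilings`): half those of the
sets `U` and `L` that consist of the positions and of dents to the left and right of them, minus
half those of two intervals.

Each energy `∑ log |s - t|` is replaced by a quadratic form in which `log |s - t|` becomes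
`meanLog (s - t)`, the mean of `log |x - y|` over a pair of unit cells; this costs `O(m ^ (3 / 2))`
for a set in an interval of length `m`.  By the parallelogram law the forms of `1_U` and `1_L`
combine to those of `w = (1_U + 1_L) / 2` and of `1_U - 1_L`.  On the cells of length `1 / n` the
derivative of `A + J` is `w`, so the first one is `n ^ 2 * ⟨A + J, A + J⟩` up to a multiple of
`log n` (`inprod_eq`).  The second one involves the dents only, not the positions, and is evaluated
in closed form, as are the two intervals (`meanForm_sub_dents`, `meanForm_Ico`).  This gives the
constant, `limitConst`, and all multiples of `log n` cancel.
-/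

namespace LozengeTiling

/-! ### Binomial determinants and interlacing sequences -/

open Polynomial in
theorem choose_eval_descPochhammer (t : ℤ) (j : ℕ) :
    (descPochhammer ℤ j).eval t = (j.factorial : ℤ) * Ring.choose t j := by
  have h := Ring.descPochhammer_eq_factorial_smul_choose t j
  rw [← Polynomial.eval_eq_smeval] at h
  simpa using h

theorem sum_Ico_choose {u v : ℤ} (huv : u ≤ v) (j : ℕ) :
    ∑ t ∈ Finset.Ico u v, Ring.choose t j
      = Ring.choose v (j + 1) - Ring.choose u (j + 1) := by
  induction v, huv using Int.leInduction with
  | base => simp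
  | succ v huv ih =>
    rw [← Finset.insert_Ico_right_eq_Ico_add_one huv,
      Finset.sum_insert Finset.right_notMem_Ico, ih, Ring.choose_succ_succ]
    ring

/-- The determinant of the binomial coefficients `(q i).choose j`. -/
def binomDet {m : ℕ} (q : Fin m → ℤ) : ℤ :=
  Matrix.det (Matrix.of fun i j : Fin m => Ring.choose (q i) (j : ℕ))

/-- The polynomials `descPochhammer ℤ j` are monic of degree `j`, so they can replace the powers in
the Vandermonde matrix. -/
theorem det_vandermonde_eq_prod_factorial_mul_binomDet {m : ℕ} (q : Fin m → ℤ) :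
    (Matrix.vandermonde q).det = (∏ j : Fin m, ((j : ℕ).factorial : ℤ)) * binomDet q := by
  rw [Matrix.det_eval_matrixOfPolynomials_eq_det_vandermonde q
    (fun j => descPochhammer ℤ (j : ℕ)) (fun j => descPochhammer_natDegree ℤ j)
    (fun j => monic_descPochhammer ℤ j), binomDet, ← Matrix.det_mul_row]
  congr 1
  ext i j
  simp [choose_eval_descPochhammer]

theorem binomDet_id (m : ℕ) : binomDet (fun i : Fin m => (i : ℤ)) = 1 := by
  rw [binomDet, Matrix.det_of_isLowerTriangular]
  · simp [Ring.choose_natCast]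
  · intro i j hij
    have : (i : ℕ) < j := hij
    simp [Ring.choose_natCast, Nat.choose_eq_zero_of_lt this]

theorem binomDet_mul_det_vandermonde_id {m : ℕ} (q : Fin m → ℤ) :
    binomDet q * (Matrix.vandermonde fun i : Fin m => (i : ℤ)).det
      = (Matrix.vandermonde q).det := by
  rw [det_vandermonde_eq_prod_factorial_mul_binomDet,
    det_vandermonde_eq_prod_factorial_mul_binomDet q, binomDet_id]
  ring

/-- Summing `binomDet` over all `q` that interlace with `p` gives `binomDet p`: the sum can be
carried out row by row, and turns the rows into differences of consecutive rows of the larger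
matrix. -/
theorem sum_binomDet_interlacing {m : ℕ} {p : Fin (m + 1) → ℤ} (hp : Monotone p) :
    ∑ q ∈ Fintype.piFinset (fun i : Fin m => Finset.Ico (p i.castSucc) (p i.succ)), binomDet q
      = binomDet p := by
  have h1 := (Matrix.detRowAlternating (n := Fin m) (R := ℤ)).toMultilinearMap.map_sum_finset
    (fun (_ : Fin m) (t : ℤ) (j : Fin m) => Ring.choose t (j : ℕ))
    (fun i : Fin m => Finset.Ico (p i.castSucc) (p i.succ))
  have h2 : ∑ q ∈ Fintype.piFinset (fun i : Fin m => Finset.Ico (p i.castSucc) (p i.succ)),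
      binomDet q = Matrix.det (Matrix.of fun i j : Fin m =>
        Ring.choose (p i.succ) ((j : ℕ) + 1) - Ring.choose (p i.castSucc) ((j : ℕ) + 1)) := by
    refine h1.symm.trans ?_
    change Matrix.det _ = _
    congr 1
    ext i j
    rw [Finset.sum_apply, sum_Ico_choose (hp i.castSucc_le_succ)]
    rfl
  rw [h2]
  -- `B` is the matrix of `p` with each row but the first replaced by its difference from the one
  -- before; its first column is `(1, 0, …, 0)`.
  let B : Matrix (Fin (m + 1)) (Fin (m + 1)) ℤ := Matrix.of (Fin.cases
    (fun j => Ring.choose (p 0) (j : ℕ))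
    (fun i j => Ring.choose (p i.succ) (j : ℕ) - Ring.choose (p i.castSucc) (j : ℕ)))
  have h3 : binomDet p = B.det := by
    refine Matrix.det_eq_of_forall_row_eq_smul_add_pred (fun _ => 1) ?_ ?_
    · intro j
      simp [B]
    · intro i j
      simp [B]
  rw [h3, Matrix.det_succ_column_zero, Fin.sum_univ_succ]
  have h4 : ∀ i : Fin m, B i.succ 0 = 0 := by
    intro i
    simp [B]
  have h5 : B 0 0 = 1 := by simp [B]
  simp only [h4, h5]
  simp only [Fin.val_zero, pow_zero, mul_zero, zero_mul, Finset.sum_const_zero, add_zero, one_mul]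
  congr 1

/-! ### Particle configurations and their chains -/

/-- The number of elements of `H` that are less than `t`. -/
def below (H : Finset ℤ) (t : ℤ) : ℕ := (H.filter (fun i => i < t)).card

theorem below_mono (H : Finset ℤ) {s t : ℤ} (h : s ≤ t) : below H s ≤ below H t :=
  Finset.card_le_card fun i hi => by
    simp only [Finset.mem_filter] at hi ⊢
    exact ⟨hi.1, by omega⟩

theorem below_le_card (H : Finset ℤ) (t : ℤ) : below H t ≤ H.card :=
  Finset.card_filter_le _ _

theorem below_add_one (H : Finset ℤ) (t : ℤ) :
    below H (t + 1) = below H t + if t ∈ H then 1 else 0 := by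
  unfold below
  split_ifs with h
  · rw [← Finset.card_insert_of_notMem (a := t) (by simp)]
    congr 1
    ext i
    simp only [Finset.mem_filter, Finset.mem_insert]
    constructor
    · rintro ⟨h1, h2⟩
      by_cases h3 : i = t
      · exact Or.inl h3
      · exact Or.inr ⟨h1, by omega⟩
    · rintro (rfl | ⟨h1, h2⟩)
      · exact ⟨h, by omega⟩
      · exact ⟨h1, by omega⟩
  · rw [add_zero]
    congr 1
    ext i
    simp only [Finset.mem_filter]
    constructor
    · rintro ⟨h1, h2⟩
      have h3 : i ≠ t := by rintro rfl; exact h h1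
      exact ⟨h1, by omega⟩
    · rintro ⟨h1, h2⟩
      exact ⟨h1, by omega⟩

theorem below_eq_zero_iff {H : Finset ℤ} {t : ℤ} : below H t = 0 ↔ ∀ i ∈ H, t ≤ i := by
  simp [below, Finset.filter_eq_empty_iff]

theorem below_eq_card_iff {H : Finset ℤ} {t : ℤ} : below H t = H.card ↔ ∀ i ∈ H, i < t := by
  simp [below, Finset.card_filter_eq_iff]

theorem below_sdiff {H I : Finset ℤ} (h : H ⊆ I) (t : ℤ) :
    below (I \ H) t + below H t = below I t := by
  unfold below
  rw [← Finset.card_union_of_disjoint]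
  · congr 1
    ext i
    simp only [Finset.mem_filter, Finset.mem_union, Finset.mem_sdiff]
    have := @h i
    tauto
  · rw [Finset.disjoint_left]
    intro i
    simp only [Finset.mem_filter, Finset.mem_sdiff]
    tauto

theorem below_Ico (u v t : ℤ) : below (Finset.Ico u v) t = (min v t - u).toNat := by
  have : (Finset.Ico u v).filter (fun i => i < t) = Finset.Ico u (min v t) := by
    ext i
    simp only [Finset.mem_filter, Finset.mem_Ico]
    omega
  rw [below, this, Int.card_Ico]

theorem subset_Ico_of_below {H : Finset ℤ} {u v : ℤ} (hu : below H u = 0)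
    (hv : H.card ≤ below H v) : H ⊆ Finset.Ico u v := by
  intro i hi
  rw [Finset.mem_Ico]
  exact ⟨below_eq_zero_iff.1 hu i hi,
    below_eq_card_iff.1 (le_antisymm (below_le_card H v) hv) i hi⟩

theorem below_eq_zero_of_subset_Ico {H : Finset ℤ} {u v t : ℤ} (h : H ⊆ Finset.Ico u v)
    (ht : t ≤ u) : below H t = 0 :=
  below_eq_zero_iff.2 fun i hi => by have := Finset.mem_Ico.1 (h hi); omega

theorem below_eq_card_of_subset_Ico {H : Finset ℤ} {u v t : ℤ} (h : H ⊆ Finset.Ico u v)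
    (ht : v ≤ t) : below H t = H.card :=
  below_eq_card_iff.2 fun i hi => by have := Finset.mem_Ico.1 (h hi); omega

theorem exists_below_eq_card (H : Finset ℤ) : ∃ v, ∀ t, v ≤ t → below H t = H.card := by
  obtain ⟨v, hv⟩ := H.bddAbove
  exact ⟨v + 1, fun t ht => below_eq_card_iff.2 fun i hi => by have := hv hi; omega⟩

/-- `Step H H'` says that the elements of `H`, seen as particles on a line, can move to `H'` when
each stays or moves one unit to the right, and no two collide: the `j`-th element of `H'` is the
`j`-th element of `H` or one more.  This is encoded by the counting functions. -/
def Step (H H' : Finset ℤ) : Prop :=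
  ∀ t, below H' t ≤ below H t ∧ below H t ≤ below H' (t + 1)

theorem Step.card_eq {H H' : Finset ℤ} (h : Step H H') : H'.card = H.card := by
  obtain ⟨v, hv⟩ := exists_below_eq_card H
  obtain ⟨v', hv'⟩ := exists_below_eq_card H'
  have h1 := h (max v v')
  rw [hv _ (le_max_left _ _), hv' _ (le_max_right _ _),
    hv' _ ((le_max_right v v').trans (by omega))] at h1
  omega

theorem Step.subset_right {H H' : Finset ℤ} (h : Step H H') {u v : ℤ}
    (hH : H ⊆ Finset.Ico u v) : H' ⊆ Finset.Ico u (v + 1) := by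
  apply subset_Ico_of_below
  · have := (h u).1
    rw [below_eq_zero_of_subset_Ico hH le_rfl] at this
    omega
  · rw [h.card_eq, ← below_eq_card_of_subset_Ico hH le_rfl]
    exact (h v).2

theorem Step.subset_left {H H' : Finset ℤ} (h : Step H H') {u v : ℤ}
    (hH : H' ⊆ Finset.Ico u v) : H ⊆ Finset.Ico (u - 1) v := by
  apply subset_Ico_of_below
  · have := (h (u - 1)).2
    rw [below_eq_zero_of_subset_Ico hH (by omega)] at this
    omega
  · rw [← h.card_eq, ← below_eq_card_of_subset_Ico hH le_rfl]
    exact (h v).1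

/-- The chains of `m` steps from `X` to `Y`, extended by the junk value `∅` to functions on `ℕ`. -/
def Chains (m : ℕ) (X Y : Finset ℤ) : Set (ℕ → Finset ℤ) :=
  {F | F 0 = X ∧ F m = Y ∧ (∀ r < m, Step (F r) (F (r + 1))) ∧ ∀ r, m < r → F r = ∅}

/-- Particles move to the right only, by at most one per step. -/
theorem Chains.subset_Ico {m : ℕ} {X Y : Finset ℤ} {F : ℕ → Finset ℤ} (hF : F ∈ Chains m X Y)
    {u v : ℤ} (hX : X ⊆ Finset.Ico u v) {r : ℕ} (hr : r ≤ m) :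
    F r ⊆ Finset.Ico u (v + r) := by
  induction r with
  | zero => simpa [hF.1] using hX
  | succ r ih =>
    have := (hF.2.2.1 r (by omega)).subset_right (ih (by omega))
    push_cast
    rwa [← add_assoc]

theorem Chains.subset_Ico' {m : ℕ} {X Y : Finset ℤ} {F : ℕ → Finset ℤ} (hF : F ∈ Chains m X Y)
    {u v : ℤ} (hY : Y ⊆ Finset.Ico u v) {r : ℕ} (hr : r ≤ m) :
    F (m - r) ⊆ Finset.Ico (u - r) v := by
  induction r with
  | zero => simpa [hF.2.1] using hY
  | succ r ih =>
    have h1 := hF.2.2.1 (m - (r + 1)) (by omega)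
    rw [show m - (r + 1) + 1 = m - r by omega] at h1
    have := h1.subset_left (ih (by omega))
    push_cast
    rwa [← sub_sub]

theorem Chains.finite (m : ℕ) (X Y : Finset ℤ) : (Chains m X Y).Finite := by
  obtain ⟨u, hu⟩ := X.bddBelow
  obtain ⟨v, hv⟩ := X.bddAbove
  have hX : X ⊆ Finset.Ico u (v + 1) := fun i hi => by
    have h1 := hu hi
    have h2 := hv hi
    rw [Finset.mem_Ico]
    omega
  let I := (Finset.Ico u (v + 1 + m)).powerset
  refine Set.Finite.of_injOn (f := fun F (r : Fin (m + 1)) => F r)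
    (t := Set.pi Set.univ fun _ => (I : Set (Finset ℤ))) ?_ ?_
    (Set.Finite.pi fun _ => I.finite_toSet)
  · intro F hF r _
    simp only [I, Finset.coe_powerset, Set.mem_preimage, Set.mem_powerset_iff, Finset.coe_subset]
    refine (Chains.subset_Ico hF hX (Nat.le_of_lt_succ r.2)).trans ?_
    apply Finset.Ico_subset_Ico_right
    have := r.2
    omega
  · intro F hF F' hF' h
    funext r
    by_cases hr : r ≤ m
    · exact congrFun h ⟨r, by omega⟩
    · rw [hF.2.2.2 r (by omega), hF'.2.2.2 r (by omega)]

theorem ncard_chains_through (k l : ℕ) (X Y Z : Finset ℤ) :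
    {F ∈ Chains (k + l) X Y | F k = Z}.ncard
      = (Chains k X Z).ncard * (Chains l Z Y).ncard := by
  rw [← Set.ncard_prod]
  refine Set.ncard_congr
    (fun F _ => (fun r => if r ≤ k then F r else ∅, fun r => F (k + r))) ?_ ?_ ?_
  · rintro F ⟨⟨h0, h1, h2, h3⟩, h4⟩
    refine ⟨⟨by simp [h0], by simp [h4], fun r hr => ?_, fun r hr => ?_⟩,
      ⟨by simp [h4], h1, fun r hr => ?_, fun r hr => h3 _ (by omega)⟩⟩
    · simpa [hr.le, Nat.succ_le_of_lt hr] using h2 r (by omega)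
    · simp [show ¬ r ≤ k by omega]
    · simpa [add_assoc] using h2 (k + r) (by omega)
  · intro F F' hF hF' h
    funext r
    by_cases hr : r ≤ k
    · simpa [hr] using congrFun (congrArg Prod.fst h) r
    · have := congrFun (congrArg Prod.snd h) (r - k)
      simpa [show k + (r - k) = r by omega] using this
  · rintro ⟨F, F'⟩ ⟨⟨h0, h1, h2, h3⟩, ⟨h0', h1', h2', h3'⟩⟩
    simp only at h0 h1 h2 h3 h0' h1' h2' h3'
    have key : ∀ r, (if k + r ≤ k then F (k + r) else F' (k + r - k)) = F' r := by
      intro r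
      split_ifs with h
      · obtain rfl : r = 0 := by omega
        rw [h0', add_zero, h1]
      · congr 1
        omega
    refine ⟨fun r => if r ≤ k then F r else F' (r - k),
      ⟨⟨by simp [h0], ?_, fun r hr => ?_, fun r hr => ?_⟩, by simp [h1]⟩, ?_⟩
    · rw [← h1']
      exact key l
    · by_cases h : r < k
      · simpa [h.le, Nat.succ_le_of_lt h] using h2 r h
      · obtain ⟨s, rfl⟩ : ∃ s, r = k + s := ⟨r - k, by omega⟩
        have h5 := h2' s (by omega)
        rw [← key s, ← key (s + 1)] at h5
        exact h5
    · simp only [show ¬ r ≤ k by omega, if_false]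
      exact h3' _ (by omega)
    · refine Prod.ext ?_ (funext key)
      funext r
      simp only
      split_ifs with h
      · rfl
      · rw [h3 r (by omega)]

theorem ncard_chains_one (Z Y : Finset ℤ) [Decidable (Step Z Y)] :
    (Chains 1 Z Y).ncard = if Step Z Y then 1 else 0 := by
  split_ifs with h
  · rw [Set.ncard_eq_one]
    refine ⟨fun r => if r = 0 then Z else if r = 1 then Y else ∅, ?_⟩
    ext F
    rw [Set.mem_singleton_iff]
    constructor
    · rintro ⟨h0, h1, -, h3⟩
      funext r
      split_ifs with hr hr'
      · rw [hr, h0]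
      · rw [hr', h1]
      · exact h3 r (by omega)
    · rintro rfl
      refine ⟨by simp, by simp, fun r hr => ?_, fun r hr => ?_⟩
      · obtain rfl : r = 0 := by omega
        simpa using h
      · simp [show r ≠ 0 by omega, show r ≠ 1 by omega]
  · rw [Set.ncard_eq_zero (Chains.finite _ _ _), Set.eq_empty_iff_forall_notMem]
    rintro F ⟨h0, h1, h2, -⟩
    have := h2 0 one_pos
    rw [h0, zero_add, h1] at this
    exact h this

open Classical in
theorem ncard_chains_succ {m : ℕ} {X : Finset ℤ} {u v : ℤ} (hX : X ⊆ Finset.Ico u v)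
    (Y : Finset ℤ) :
    (Chains (m + 1) X Y).ncard
      = ∑ Z ∈ (Finset.Ico u (v + m)).powerset with Step Z Y, (Chains m X Z).ncard := by
  have hfin := Chains.finite (m + 1) X Y
  rw [Set.ncard_eq_toFinset_card _ hfin,
    Finset.card_eq_sum_card_fiberwise (f := fun F => F m)
      (t := (Finset.Ico u (v + m)).powerset.filter (fun Z => Step Z Y))]
  · refine Finset.sum_congr rfl fun Z hZ => ?_
    rw [Finset.mem_filter] at hZ
    have h1 := ncard_chains_through m 1 X Y Z
    rw [ncard_chains_one, if_pos hZ.2, mul_one] at h1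
    rw [← h1, ← Set.ncard_coe_finset]
    congr 1
    ext F
    simp
  · intro F hF
    have hF : F ∈ Chains (m + 1) X Y := by simpa using hF
    simp only [Finset.coe_filter, Finset.mem_powerset, Set.mem_ofPred_eq]
    refine ⟨Chains.subset_Ico hF hX (by omega), ?_⟩
    have := hF.2.2.1 m (by omega)
    rwa [hF.2.1] at this

/-- The reflection of `H` in the point `s / 2`. -/
def reflect (s : ℤ) (H : Finset ℤ) : Finset ℤ := H.image (fun i => s - i)

theorem mem_reflect {s : ℤ} {H : Finset ℤ} {i : ℤ} : i ∈ reflect s H ↔ s - i ∈ H := by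
  simp only [reflect, Finset.mem_image]
  constructor
  · rintro ⟨j, hj, rfl⟩
    simpa using hj
  · intro h
    exact ⟨_, h, by omega⟩

theorem reflect_reflect (s : ℤ) (H : Finset ℤ) : reflect s (reflect s H) = H := by
  ext i
  simp [mem_reflect]

theorem card_reflect (s : ℤ) (H : Finset ℤ) : (reflect s H).card = H.card :=
  Finset.card_image_of_injective _ fun i j h => by simpa using h

theorem below_reflect (s : ℤ) (H : Finset ℤ) (t : ℤ) :
    below (reflect s H) t + below H (s - t + 1) = H.card := by
  have h1 : below (reflect s H) t = (H.filter (fun i => ¬ i < s - t + 1)).card := by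
    rw [below, ← card_reflect s (H.filter _)]
    congr 1
    ext i
    simp only [Finset.mem_filter, mem_reflect]
    constructor
    · rintro ⟨h, h'⟩
      exact ⟨h, by omega⟩
    · rintro ⟨h, h'⟩
      exact ⟨h, by omega⟩
  rw [h1, below, add_comm, Finset.card_filter_add_card_filter_not]

theorem Step.reflect {H H' : Finset ℤ} (h : Step H H') (s : ℤ) :
    Step (reflect s H') (reflect s H) := by
  intro t
  have h1 := below_reflect s H t
  have h2 := below_reflect s H' t
  have h3 := below_reflect s H (t + 1)
  have h4 := h (s - t + 1)
  have h5 := h (s - (t + 1) + 1)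
  have h6 := h.card_eq
  rw [show s - (t + 1) + 1 + 1 = s - t + 1 by ring] at h5
  omega

theorem Chains.reflect {m : ℕ} {X Y : Finset ℤ} {F : ℕ → Finset ℤ} (hF : F ∈ Chains m X Y)
    (s : ℤ) :
    (fun r => if r ≤ m then LozengeTiling.reflect s (F (m - r)) else ∅)
      ∈ Chains m (LozengeTiling.reflect s Y) (LozengeTiling.reflect s X) := by
  refine ⟨by simp [hF.2.1], by simp [hF.1], fun r hr => ?_, fun r hr => ?_⟩
  · simp only [hr.le, if_true, Nat.succ_le_of_lt hr]
    have h1 := (hF.2.2.1 (m - (r + 1)) (by omega)).reflect s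
    rwa [show m - (r + 1) + 1 = m - r by omega] at h1
  · simp [show ¬ r ≤ m by omega]

theorem ncard_chains_reflect (m : ℕ) (X Y : Finset ℤ) (s : ℤ) :
    (Chains m X Y).ncard = (Chains m (reflect s Y) (reflect s X)).ncard := by
  have key : ∀ {X Y : Finset ℤ} {F : ℕ → Finset ℤ}, F ∈ Chains m X Y →
      (fun r => if r ≤ m then reflect s
        ((fun r => if r ≤ m then reflect s (F (m - r)) else ∅) (m - r)) else ∅) = F := by
    intro X Y F hF
    funext r
    by_cases hr : r ≤ m
    · simp [hr, reflect_reflect, show m - (m - r) = r by omega]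
    · simp [hr, hF.2.2.2 r (by omega)]
  refine Set.ncard_congr (fun F _ r => if r ≤ m then reflect s (F (m - r)) else ∅)
    (fun F hF => Chains.reflect hF s) ?_ ?_
  · intro F F' hF hF' h
    rw [← key hF, ← key hF']
    exact congrArg
      (fun (F : ℕ → Finset ℤ) (r : ℕ) => if r ≤ m then reflect s (F (m - r)) else ∅) h
  · intro F hF
    refine ⟨fun r => if r ≤ m then reflect s (F (m - r)) else ∅, ?_, key hF⟩
    have := Chains.reflect hF s
    rwa [reflect_reflect, reflect_reflect] at this

/-! ### Counting chains by Gelfand-Tsetlin patterns -/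

/-- The determinant `binomDet` of the elements of `Q` in increasing order.  It is the number of
Gelfand-Tsetlin patterns with strict bottom row `Q`. -/
def patternCount (Q : Finset ℤ) : ℤ := binomDet (Q.orderEmbOfFin rfl)

theorem patternCount_eq {Q : Finset ℤ} {m : ℕ} (h : Q.card = m) :
    patternCount Q = binomDet (Q.orderEmbOfFin h) := by
  subst h
  rfl

theorem orderEmbOfFin_lt_iff {Q : Finset ℤ} {m : ℕ} (h : Q.card = m) (i : Fin m) (t : ℤ) :
    Q.orderEmbOfFin h i < t ↔ (i : ℕ) < below Q t := by
  have h1 : Q.filter (fun j => j < t)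
      = (Finset.univ.filter (fun j : Fin m => Q.orderEmbOfFin h j < t)).image
          (Q.orderEmbOfFin h) := by
    have h2 := Finset.filter_image (s := Finset.univ) (f := Q.orderEmbOfFin h) (p := fun j => j < t)
    rwa [Finset.image_orderEmbOfFin_univ] at h2
  rw [below, h1, Finset.card_image_of_injective _ (Q.orderEmbOfFin h).injective]
  constructor
  · intro hi
    have h2 : Finset.Iic i ⊆ Finset.univ.filter (fun j => Q.orderEmbOfFin h j < t) := by
      intro j hj
      rw [Finset.mem_Iic] at hj
      simp only [Finset.mem_filter, Finset.mem_univ, true_and]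
      exact ((Q.orderEmbOfFin h).monotone hj).trans_lt hi
    have := Finset.card_le_card h2
    rw [Fin.card_Iic] at this
    omega
  · intro hi
    by_contra hlt
    have h2 : Finset.univ.filter (fun j => Q.orderEmbOfFin h j < t) ⊆ Finset.Iio i := by
      intro j hj
      simp only [Finset.mem_filter, Finset.mem_univ, true_and] at hj
      rw [Finset.mem_Iio]
      by_contra hij
      exact hlt (((Q.orderEmbOfFin h).monotone (not_lt.1 hij)).trans_lt hj)
    have := Finset.card_le_card h2
    rw [Fin.card_Iio] at this
    omega

/-- `Interlace P Q` says that between any two consecutive elements `p < p'` of `P` there is exactly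
one element `q` of `Q`, in the sense `p ≤ q < p'`, and that `Q` has no others. -/
def Interlace (P Q : Finset ℤ) : Prop :=
  ∀ t, below Q t ≤ below P t ∧ below P (t + 1) ≤ below Q t + 1

/-- The encoding by counting functions agrees with the usual one by elements in increasing order. -/
theorem interlace_iff {P Q : Finset ℤ} {m : ℕ} (hP : P.card = m + 1) (hQ : Q.card = m) :
    Interlace P Q ↔ ∀ i : Fin m, P.orderEmbOfFin hP i.castSucc ≤ Q.orderEmbOfFin hQ i ∧
      Q.orderEmbOfFin hQ i < P.orderEmbOfFin hP i.succ := by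
  constructor
  · intro h i
    -- The number of elements of `Q` below `q` is `i`, and below `q + 1` it is `i + 1`.
    set q := Q.orderEmbOfFin hQ i
    have h1 : (i : ℕ) < below Q (q + 1) := (orderEmbOfFin_lt_iff hQ i _).1 (by omega)
    have h2 : ¬ (i : ℕ) < below Q q := fun h' => absurd ((orderEmbOfFin_lt_iff hQ i _).2 h')
      (lt_irrefl _)
    constructor
    · have h3 := (orderEmbOfFin_lt_iff hP i.castSucc (q + 1)).2
        (by rw [Fin.val_castSucc]; have := (h (q + 1)).1; omega)
      omega
    · by_contra h4
      have h3 := (orderEmbOfFin_lt_iff hP i.succ (q + 1)).1 (by omega)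
      rw [Fin.val_succ] at h3
      have := (h q).2
      omega
  · intro h t
    constructor
    · by_contra! hlt
      have h1 := below_le_card Q t
      have h2 := (orderEmbOfFin_lt_iff hQ ⟨below Q t - 1, by omega⟩ t).2
        (by simp only; omega)
      have h3 := (orderEmbOfFin_lt_iff hP _ t).1 ((h _).1.trans_lt h2)
      simp only [Fin.val_castSucc] at h3
      omega
    · by_contra! hlt
      have h1 := below_le_card P (t + 1)
      have h2 := (orderEmbOfFin_lt_iff hP (Fin.succ ⟨below P (t + 1) - 2, by omega⟩) (t + 1)).2
        (by simp only [Fin.val_succ]; omega)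
      have h3 := (orderEmbOfFin_lt_iff hQ _ t).1 ((h _).2.trans_le (Int.lt_add_one_iff.1 h2))
      simp only at h3
      omega

theorem sum_patternCount_interlace {P : Finset ℤ} {m : ℕ} (hP : P.card = m + 1)
    {R : Finset (Finset ℤ)} (hR : ∀ Q, Q ∈ R ↔ Q.card = m ∧ Interlace P Q) :
    ∑ Q ∈ R, patternCount Q = patternCount P := by
  rw [patternCount_eq hP, ← sum_binomDet_interlacing (P.orderEmbOfFin hP).monotone]
  have hmem : ∀ q, q ∈ Fintype.piFinset (fun i : Fin m => Finset.Ico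
      (P.orderEmbOfFin hP i.castSucc) (P.orderEmbOfFin hP i.succ)) ↔
      ∀ i : Fin m, P.orderEmbOfFin hP i.castSucc ≤ q i ∧ q i < P.orderEmbOfFin hP i.succ := by
    simp
  refine Finset.sum_bij (fun Q hQ => Q.orderEmbOfFin ((hR Q).1 hQ).1) ?_ ?_ ?_ ?_
  · intro Q hQ
    rw [hmem]
    exact (interlace_iff hP ((hR Q).1 hQ).1).1 ((hR Q).1 hQ).2
  · intro Q hQ Q' hQ' h
    rw [← Finset.image_orderEmbOfFin_univ Q ((hR Q).1 hQ).1,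
      ← Finset.image_orderEmbOfFin_univ Q' ((hR Q').1 hQ').1, h]
  · intro q hq
    rw [hmem] at hq
    -- Interlacing forces `q` to be strictly increasing: `q i < p (i + 1) ≤ p j ≤ q j` for `i < j`.
    have hmono : StrictMono q := by
      intro i j hij
      have h1 : i.succ ≤ j.castSucc := by
        rw [Fin.le_def, Fin.val_succ, Fin.val_castSucc]
        exact hij
      exact (hq i).2.trans_le (((P.orderEmbOfFin hP).monotone h1).trans (hq j).1)
    have hcard : (Finset.univ.image q).card = m := by
      rw [Finset.card_image_of_injective _ hmono.injective, Finset.card_fin]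
    have hq' : q = (Finset.univ.image q).orderEmbOfFin hcard :=
      Finset.orderEmbOfFin_unique hcard (fun i => Finset.mem_image_of_mem q (Finset.mem_univ i))
        hmono
    refine ⟨Finset.univ.image q, (hR _).2 ⟨hcard, (interlace_iff hP hcard).2 ?_⟩, hq'.symm⟩
    rw [← hq']
    exact hq
  · intro Q hQ
    exact patternCount_eq _

/-- Passing to complements turns steps of particles into interlacing sets. -/
theorem step_iff_interlace {b m : ℕ} {Z Y : Finset ℤ} (hZ : Z ⊆ Finset.Ico 0 ((b : ℤ) + m))
    (hY : Y ⊆ Finset.Ico 0 ((b : ℤ) + m + 1)) (hYc : Y.card = b) (hZc : Z.card = b) :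
    Step Z Y ↔ Interlace (Finset.Ico 0 ((b : ℤ) + m + 1) \ Y) (Finset.Ico 0 ((b : ℤ) + m) \ Z) := by
  refine forall_congr' fun t => ?_
  have h1 := below_sdiff hZ t
  have h2 := below_sdiff hY t
  have h3 := below_sdiff hY (t + 1)
  rw [below_Ico] at h1 h2 h3
  have h4 := below_mono Y (show t ≤ t + 1 by omega)
  have h5 := below_le_card Y (t + 1)
  have h6 := below_le_card Z t
  rcases lt_or_ge t 0 with ht | ht
  · rw [below_eq_zero_of_subset_Ico hZ ht.le] at *
    rw [below_eq_zero_of_subset_Ico hY ht.le] at *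
    rw [below_eq_zero_of_subset_Ico hY (show t + 1 ≤ 0 by omega)] at *
    omega
  · rcases le_or_gt t (b + m) with ht' | ht'
    · omega
    · rw [below_eq_card_of_subset_Ico hZ ht'.le] at *
      rw [below_eq_card_of_subset_Ico hY (show (b : ℤ) + m + 1 ≤ t by omega)] at *
      rw [below_eq_card_of_subset_Ico hY (show (b : ℤ) + m + 1 ≤ t + 1 by omega)] at *
      omega

theorem card_Ico_sdiff {b m : ℕ} {H : Finset ℤ} (hH : H ⊆ Finset.Ico 0 ((b : ℤ) + m))
    (hc : H.card = b) : (Finset.Ico 0 ((b : ℤ) + m) \ H).card = m := by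
  rw [Finset.card_sdiff_of_subset hH, Int.card_Ico, hc]
  omega

/-- The chains that start with `b` adjacent particles are counted by Gelfand-Tsetlin patterns, whose
rows are the sets of positions not occupied by particles. -/
theorem ncard_chains_eq_patternCount {b m : ℕ} {H : Finset ℤ}
    (hH : H ⊆ Finset.Ico 0 ((b : ℤ) + m)) (hc : H.card = b) :
    ((Chains m (Finset.Ico 0 (b : ℤ)) H).ncard : ℤ)
      = patternCount (Finset.Ico 0 ((b : ℤ) + m) \ H) := by
  classical
  induction m generalizing H with
  | zero =>
    rw [patternCount_eq (card_Ico_sdiff hH hc)]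
    have h1 : H = Finset.Ico 0 (b : ℤ) := by
      refine Finset.eq_of_subset_of_card_le (by simpa using hH) ?_
      simp [hc]
    have h2 : (Chains 0 (Finset.Ico 0 (b : ℤ)) H).ncard = 1 := by
      rw [Set.ncard_eq_one]
      refine ⟨fun r => if r = 0 then H else ∅, ?_⟩
      ext F
      rw [Set.mem_singleton_iff]
      constructor
      · rintro ⟨-, h0, -, h3⟩
        funext r
        split_ifs with hr
        · rw [hr, h0]
        · exact h3 r (by omega)
      · rintro rfl
        exact ⟨by simp [h1], by simp, fun r hr => by omega, fun r hr => by simp [hr.ne']⟩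
    rw [h2, binomDet, Matrix.det_fin_zero]
    rfl
  | succ m ih =>
    have hH' : H ⊆ Finset.Ico 0 ((b : ℤ) + m + 1) := by
      rw [add_assoc]
      exact_mod_cast hH
    have hP : (Finset.Ico 0 ((b : ℤ) + m + 1) \ H).card = m + 1 := by
      have := card_Ico_sdiff hH hc
      push_cast at this
      rwa [← add_assoc] at this
    rw [ncard_chains_succ subset_rfl]
    push_cast
    rw [← add_assoc, ← sum_patternCount_interlace hP
      (R := ((Finset.Ico 0 ((b : ℤ) + m)).powerset.filter (fun Z => Step Z H)).image
        (fun Z => Finset.Ico 0 ((b : ℤ) + m) \ Z)), Finset.sum_image]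
    · refine Finset.sum_congr rfl fun Z hZ => ?_
      rw [Finset.mem_filter, Finset.mem_powerset] at hZ
      exact ih hZ.1 (by rw [← hZ.2.card_eq, hc])
    · intro Z hZ Z' hZ' h
      rw [Finset.mem_coe, Finset.mem_filter, Finset.mem_powerset] at hZ hZ'
      simp only at h
      rw [← Finset.sdiff_sdiff_eq_self hZ.1, h, Finset.sdiff_sdiff_eq_self hZ'.1]
    · intro Q
      simp only [Finset.mem_image, Finset.mem_filter, Finset.mem_powerset]
      constructor
      · rintro ⟨Z, ⟨hZ, hs⟩, rfl⟩
        have hZc : Z.card = b := by rw [← hs.card_eq, hc]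
        exact ⟨card_Ico_sdiff hZ hZc, (step_iff_interlace hZ hH' hc hZc).1 hs⟩
      · rintro ⟨hQc, hQ⟩
        have hQI : Q ⊆ Finset.Ico 0 ((b : ℤ) + m) := by
          apply subset_Ico_of_below
          · have := (hQ 0).1
            rw [below_eq_zero_of_subset_Ico Finset.sdiff_subset le_rfl] at this
            omega
          · have := (hQ (b + m)).2
            rw [below_eq_card_of_subset_Ico Finset.sdiff_subset le_rfl, hP] at this
            omega
        have hZ : Finset.Ico 0 ((b : ℤ) + m) \ Q ⊆ Finset.Ico 0 ((b : ℤ) + m) :=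
          Finset.sdiff_subset
        have hZc : (Finset.Ico 0 ((b : ℤ) + m) \ Q).card = b := by
          rw [Finset.card_sdiff_of_subset hQI, Int.card_Ico, hQc]
          omega
        refine ⟨_, ⟨hZ, (step_iff_interlace hZ hH' hc hZc).2 ?_⟩,
          Finset.sdiff_sdiff_eq_self hQI⟩
        rwa [Finset.sdiff_sdiff_eq_self hQI]

/-! ### Lozenge tilings as chains of particle configurations -/

/-- The unit edges of the `r`-th line that lie in the hexagon, each given by the first coordinate
of its left end. -/
noncomputable def edges (a b c r : ℕ) : Finset ℤ :=
  Finset.Ico (leftBorder a r) (min ((b : ℤ) + c) (b + r))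

theorem mem_edges {a b c r : ℕ} {i : ℤ} : i ∈ edges a b c r ↔
    0 ≤ i ∧ (r : ℤ) - a ≤ i ∧ i < (b : ℤ) + c ∧ i < (b : ℤ) + r := by
  rw [edges, leftBorder, Finset.mem_Ico]
  omega

theorem mem_hexagonPoints {a b c : ℕ} {i r : ℤ} : (i, r) ∈ hexagonPoints a b c ↔
    0 ≤ r ∧ r ≤ a + c ∧ 0 ≤ i ∧ i ≤ b + c ∧ -(a : ℤ) ≤ i - r ∧ i - r ≤ b := Iff.rfl

theorem up_mem_hexagon {a b c : ℕ} {i r : ℤ} : Triangle.up i r ∈ hexagon a b c ↔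
    0 ≤ r ∧ r < a + c ∧ i ∈ edges a b c (r.toNat + 1) := by
  have : Triangle.up i r ∈ hexagon a b c ↔ (i, r) ∈ hexagonPoints a b c ∧
      (i, r + 1) ∈ hexagonPoints a b c ∧ (i + 1, r + 1) ∈ hexagonPoints a b c := by
    simp only [hexagon, Triangle.vertices, Set.mem_ofPred_eq, Set.insert_subset_iff,
      Set.singleton_subset_iff]
  rw [this, mem_hexagonPoints, mem_hexagonPoints, mem_hexagonPoints, mem_edges]
  push_cast
  omega

theorem down_mem_hexagon {a b c : ℕ} {i r : ℤ} : Triangle.down i r ∈ hexagon a b c ↔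
    0 ≤ r ∧ r < a + c ∧ i ∈ edges a b c r.toNat := by
  have : Triangle.down i r ∈ hexagon a b c ↔ (i, r) ∈ hexagonPoints a b c ∧
      (i + 1, r) ∈ hexagonPoints a b c ∧ (i + 1, r + 1) ∈ hexagonPoints a b c := by
    simp only [hexagon, Triangle.vertices, Set.mem_ofPred_eq, Set.insert_subset_iff,
      Set.singleton_subset_iff]
  rw [this, mem_hexagonPoints, mem_hexagonPoints, mem_hexagonPoints, mem_edges]
  omega

theorem up_mem_vertical {i r j s : ℤ} :
    Triangle.up i r ∈ (Lozenge.vertical j s).triangles ↔ i = j ∧ r = s - 1 := by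
  simp [Lozenge.triangles]

theorem up_mem_left {i r j s : ℤ} :
    Triangle.up i r ∈ (Lozenge.left j s).triangles ↔ i = j ∧ r = s := by
  simp [Lozenge.triangles]

theorem up_mem_right {i r j s : ℤ} :
    Triangle.up i r ∈ (Lozenge.right j s).triangles ↔ i = j ∧ r = s := by
  simp [Lozenge.triangles]

theorem down_mem_vertical {i r j s : ℤ} :
    Triangle.down i r ∈ (Lozenge.vertical j s).triangles ↔ i = j ∧ r = s := by
  simp [Lozenge.triangles]

theorem down_mem_left {i r j s : ℤ} :
    Triangle.down i r ∈ (Lozenge.left j s).triangles ↔ i = j - 1 ∧ r = s := by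
  simp [Lozenge.triangles]

theorem down_mem_right {i r j s : ℤ} :
    Triangle.down i r ∈ (Lozenge.right j s).triangles ↔ i = j ∧ r = s := by
  simp [Lozenge.triangles]

theorem vertical_triangles_subset {i r : ℤ} {X : Set Triangle} :
    (Lozenge.vertical i r).triangles ⊆ X ↔ Triangle.up i (r - 1) ∈ X ∧ Triangle.down i r ∈ X := by
  simp [Lozenge.triangles, Set.insert_subset_iff]

theorem left_triangles_subset {i r : ℤ} {X : Set Triangle} :
    (Lozenge.left i r).triangles ⊆ X ↔ Triangle.up i r ∈ X ∧ Triangle.down (i - 1) r ∈ X := by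
  simp [Lozenge.triangles, Set.insert_subset_iff]

theorem right_triangles_subset {i r : ℤ} {X : Set Triangle} :
    (Lozenge.right i r).triangles ⊆ X ↔ Triangle.up i r ∈ X ∧ Triangle.down i r ∈ X := by
  simp [Lozenge.triangles, Set.insert_subset_iff]

open Classical in
/-- The edges on the `r`-th line that do not bisect a vertical lozenge of `T`. -/
noncomputable def freeEdges (a b c : ℕ) (T : Set Lozenge) (r : ℕ) : Finset ℤ :=
  (edges a b c r).filter (fun i => Lozenge.vertical i r ∉ T)

theorem mem_freeEdges {a b c r : ℕ} {T : Set Lozenge} {i : ℤ} :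
    i ∈ freeEdges a b c T r ↔ i ∈ edges a b c r ∧ Lozenge.vertical i r ∉ T := by
  simp [freeEdges]

namespace IsTiling

variable {a b c : ℕ} {T : Set Lozenge}

theorem eq_of_mem (hT : IsTiling a b c T) {L L' : Lozenge} (hL : L ∈ T) (hL' : L' ∈ T)
    {t : Triangle} (ht : t ∈ L.triangles) (ht' : t ∈ L'.triangles) : L = L' :=
  (hT.covered_once t (hT.inside L hL ht)).unique ⟨hL, ht⟩ ⟨hL', ht'⟩

/-- A tiling cannot be properly contained in another one. -/
theorem eq_of_subset {T' : Set Lozenge} (hT : IsTiling a b c T) (hT' : IsTiling a b c T')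
    (h : T ⊆ T') : T = T' := by
  refine Set.Subset.antisymm h fun L hL => ?_
  have hne : ∃ t, t ∈ L.triangles := by
    cases L with
    | vertical i r => exact ⟨_, down_mem_vertical.2 ⟨rfl, rfl⟩⟩
    | left i r => exact ⟨_, up_mem_left.2 ⟨rfl, rfl⟩⟩
    | right i r => exact ⟨_, up_mem_right.2 ⟨rfl, rfl⟩⟩
  obtain ⟨t, ht⟩ := hne
  obtain ⟨L', ⟨hL', ht'⟩, -⟩ := hT.covered_once t (hT'.inside L hL ht)
  rwa [hT'.eq_of_mem hL (h hL') ht ht']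

theorem vertical_mem (hT : IsTiling a b c T) {i r : ℤ} (h : Lozenge.vertical i r ∈ T) :
    1 ≤ r ∧ r < a + c ∧ i ∈ edges a b c r.toNat := by
  have h1 := vertical_triangles_subset.1 (hT.inside _ h)
  have h2 := up_mem_hexagon.1 h1.1
  have h3 := down_mem_hexagon.1 h1.2
  exact ⟨by omega, h3.2.1, h3.2.2⟩

theorem right_mem (hT : IsTiling a b c T) {i r : ℤ} (h : Lozenge.right i r ∈ T) :
    0 ≤ r ∧ r < a + c ∧ i ∈ freeEdges a b c T r.toNat ∧ i ∈ freeEdges a b c T (r.toNat + 1) := by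
  have h1 := right_triangles_subset.1 (hT.inside _ h)
  have h2 := up_mem_hexagon.1 h1.1
  have h3 := down_mem_hexagon.1 h1.2
  refine ⟨h2.1, h2.2.1, mem_freeEdges.2 ⟨h3.2.2, fun hv => ?_⟩,
    mem_freeEdges.2 ⟨h2.2.2, fun hv => ?_⟩⟩
  · have := hT.eq_of_mem h hv (t := .down i r) (down_mem_right.2 ⟨rfl, rfl⟩)
      (down_mem_vertical.2 ⟨rfl, by omega⟩)
    cases this
  · have := hT.eq_of_mem h hv (t := .up i r) (up_mem_right.2 ⟨rfl, rfl⟩)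
      (up_mem_vertical.2 ⟨rfl, by push_cast; omega⟩)
    cases this

theorem left_mem (hT : IsTiling a b c T) {i r : ℤ} (h : Lozenge.left i r ∈ T) :
    0 ≤ r ∧ r < a + c ∧ i - 1 ∈ freeEdges a b c T r.toNat ∧
      i ∈ freeEdges a b c T (r.toNat + 1) := by
  have h1 := left_triangles_subset.1 (hT.inside _ h)
  have h2 := up_mem_hexagon.1 h1.1
  have h3 := down_mem_hexagon.1 h1.2
  refine ⟨h2.1, h2.2.1, mem_freeEdges.2 ⟨h3.2.2, fun hv => ?_⟩,
    mem_freeEdges.2 ⟨h2.2.2, fun hv => ?_⟩⟩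
  · have := hT.eq_of_mem h hv (t := .down (i - 1) r) (down_mem_left.2 ⟨rfl, rfl⟩)
      (down_mem_vertical.2 ⟨rfl, by omega⟩)
    cases this
  · have := hT.eq_of_mem h hv (t := .up i r) (up_mem_left.2 ⟨rfl, rfl⟩)
      (up_mem_vertical.2 ⟨rfl, by push_cast; omega⟩)
    cases this

theorem left_notMem_of_right_mem (hT : IsTiling a b c T) {i r : ℤ} (h : Lozenge.right i r ∈ T) :
    Lozenge.left i r ∉ T ∧ Lozenge.left (i + 1) r ∉ T := by
  constructor
  · intro hl
    have := hT.eq_of_mem h hl (t := .up i r) (up_mem_right.2 ⟨rfl, rfl⟩)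
      (up_mem_left.2 ⟨rfl, rfl⟩)
    cases this
  · intro hl
    have := hT.eq_of_mem h hl (t := .down i r) (down_mem_right.2 ⟨rfl, rfl⟩)
      (down_mem_left.2 ⟨by omega, rfl⟩)
    cases this

theorem right_or_left_of_mem_freeEdges (hT : IsTiling a b c T) {i : ℤ} {r : ℕ} (hr : r < a + c)
    (hi : i ∈ freeEdges a b c T r) : Lozenge.right i r ∈ T ∨ Lozenge.left (i + 1) r ∈ T := by
  rw [mem_freeEdges] at hi
  obtain ⟨L, ⟨hL, ht⟩, -⟩ := hT.covered_once (.down i r)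
    (down_mem_hexagon.2 ⟨by omega, by omega, by simpa using hi.1⟩)
  cases L with
  | vertical j s =>
    obtain ⟨rfl, rfl⟩ := down_mem_vertical.1 ht
    exact absurd hL hi.2
  | left j s =>
    obtain ⟨h, rfl⟩ := down_mem_left.1 ht
    obtain rfl : j = i + 1 := by omega
    exact Or.inr hL
  | right j s =>
    obtain ⟨rfl, rfl⟩ := down_mem_right.1 ht
    exact Or.inl hL

theorem right_or_left_of_mem_freeEdges_succ (hT : IsTiling a b c T) {i : ℤ} {r : ℕ}
    (hr : r < a + c) (hi : i ∈ freeEdges a b c T (r + 1)) :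
    Lozenge.right i r ∈ T ∨ Lozenge.left i r ∈ T := by
  rw [mem_freeEdges] at hi
  obtain ⟨L, ⟨hL, ht⟩, -⟩ := hT.covered_once (.up i r)
    (up_mem_hexagon.2 ⟨by omega, by omega, by simpa using hi.1⟩)
  cases L with
  | vertical j s =>
    obtain ⟨rfl, h⟩ := up_mem_vertical.1 ht
    obtain rfl : s = ((r + 1 : ℕ) : ℤ) := by push_cast; omega
    exact absurd hL hi.2
  | left j s =>
    obtain ⟨rfl, rfl⟩ := up_mem_left.1 ht
    exact Or.inr hL
  | right j s =>
    obtain ⟨rfl, rfl⟩ := up_mem_right.1 ht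
    exact Or.inl hL

/-- Following the lozenges downwards, from a free edge to the opposite side, is injective.  So if it
takes the free edges left of `t` to edges left of `t'`, there are at least as many of the latter. -/
theorem below_freeEdges_le_succ (hT : IsTiling a b c T) {r : ℕ} (hr : r < a + c) {t t' : ℤ}
    (htt : ∀ i, Lozenge.right i r ∈ T → i < t → i < t')
    (htt' : ∀ i, Lozenge.left (i + 1) r ∈ T → i < t → i + 1 < t') :
    below (freeEdges a b c T r) t ≤ below (freeEdges a b c T (r + 1)) t' := by
  classical
  refine Finset.card_le_card_of_injOn
    (fun i => if Lozenge.right i r ∈ T then i else i + 1) ?_ ?_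
  · intro i hi
    rw [Finset.mem_coe, Finset.mem_filter] at hi ⊢
    simp only
    split_ifs with h
    · exact ⟨by simpa using (hT.right_mem h).2.2.2, htt i h hi.2⟩
    · have h' := (hT.right_or_left_of_mem_freeEdges hr hi.1).resolve_left h
      exact ⟨by simpa using (hT.left_mem h').2.2.2, htt' i h' hi.2⟩
  · intro i hi j hj hij
    rw [Finset.mem_coe, Finset.mem_filter] at hi hj
    have hi' := hT.right_or_left_of_mem_freeEdges hr hi.1
    have hj' := hT.right_or_left_of_mem_freeEdges hr hj.1
    simp only at hij
    split_ifs at hij with h1 h2 h2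
    · exact hij
    · subst hij
      exact absurd (hj'.resolve_left h2) (hT.left_notMem_of_right_mem h1).1
    · subst hij
      exact absurd (hi'.resolve_left h1) (hT.left_notMem_of_right_mem h2).1
    · omega

/-- The analogue of `below_freeEdges_le_succ` for following the lozenges upwards. -/
theorem below_freeEdges_succ_le (hT : IsTiling a b c T) {r : ℕ} (hr : r < a + c) {t t' : ℤ}
    (htt : ∀ i, Lozenge.right i r ∈ T → i < t → i < t')
    (htt' : ∀ i, Lozenge.left i r ∈ T → i < t → i - 1 < t') :
    below (freeEdges a b c T (r + 1)) t ≤ below (freeEdges a b c T r) t' := by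
  classical
  refine Finset.card_le_card_of_injOn
    (fun i => if Lozenge.right i r ∈ T then i else i - 1) ?_ ?_
  · intro i hi
    rw [Finset.mem_coe, Finset.mem_filter] at hi ⊢
    simp only
    split_ifs with h
    · exact ⟨by simpa using (hT.right_mem h).2.2.1, htt i h hi.2⟩
    · have h' := (hT.right_or_left_of_mem_freeEdges_succ hr hi.1).resolve_left h
      exact ⟨by simpa using (hT.left_mem h').2.2.1, htt' i h' hi.2⟩
  · intro i hi j hj hij
    rw [Finset.mem_coe, Finset.mem_filter] at hi hj
    have hi' := hT.right_or_left_of_mem_freeEdges_succ hr hi.1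
    have hj' := hT.right_or_left_of_mem_freeEdges_succ hr hj.1
    simp only at hij
    split_ifs at hij with h1 h2 h2
    · exact hij
    · obtain rfl : j = i + 1 := by omega
      exact absurd (hj'.resolve_left h2) (hT.left_notMem_of_right_mem h1).2
    · obtain rfl : i = j + 1 := by omega
      exact absurd (hi'.resolve_left h1) (hT.left_notMem_of_right_mem h2).2
    · omega

theorem step (hT : IsTiling a b c T) {r : ℕ} (hr : r < a + c) :
    Step (freeEdges a b c T r) (freeEdges a b c T (r + 1)) := fun t =>
  ⟨hT.below_freeEdges_succ_le hr (fun _ _ h => h) (fun _ _ h => by omega),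
    hT.below_freeEdges_le_succ hr (fun _ _ h => by omega) (fun _ _ h => by omega)⟩

/-- A right lozenge joins free edges with the same number of free edges to their left. -/
theorem below_eq_of_right_mem (hT : IsTiling a b c T) {i : ℤ} {r : ℕ} (hr : r < a + c)
    (h : Lozenge.right i r ∈ T) :
    below (freeEdges a b c T r) i = below (freeEdges a b c T (r + 1)) i := by
  refine le_antisymm (hT.below_freeEdges_le_succ hr (fun _ _ h => h) fun j hj hji => ?_)
    (hT.step hr i).1
  have : j + 1 ≠ i := by
    rintro rfl
    exact (hT.left_notMem_of_right_mem h).1 hj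
  omega

/-- A left lozenge joins free edges with the same number of free edges to their left. -/
theorem below_eq_of_left_mem (hT : IsTiling a b c T) {i : ℤ} {r : ℕ} (hr : r < a + c)
    (h : Lozenge.left i r ∈ T) :
    below (freeEdges a b c T r) (i - 1) = below (freeEdges a b c T (r + 1)) i := by
  refine le_antisymm (by simpa using (hT.step hr (i - 1)).2)
    (hT.below_freeEdges_succ_le hr (fun j hj hji => ?_) fun _ _ _ => by omega)
  have : j ≠ i - 1 := by
    rintro rfl
    exact (hT.left_notMem_of_right_mem hj).2 (by simpa using h)
  omega

end IsTiling

/-- The sequence of the sets of free edges on the lines `0, …, a + c`, continued by `∅`. -/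
noncomputable def chainOfTiling (a b c : ℕ) (T : Set Lozenge) (r : ℕ) : Finset ℤ :=
  if r ≤ a + c then freeEdges a b c T r else ∅

theorem IsTiling.chainOfTiling_mem {a b c : ℕ} {T : Set Lozenge} (hT : IsTiling a b c T) :
    chainOfTiling a b c T ∈ Chains (a + c) (Finset.Ico 0 (b : ℤ)) (Finset.Ico (c : ℤ) (b + c)) := by
  refine ⟨?_, ?_, fun r hr => ?_, fun r hr => ?_⟩
  · ext i
    rw [chainOfTiling, if_pos (Nat.zero_le _), mem_freeEdges, mem_edges, Finset.mem_Ico]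
    constructor
    · rintro ⟨h, -⟩
      push_cast at h
      omega
    · intro h
      refine ⟨by push_cast; omega, fun hv => ?_⟩
      have := (hT.vertical_mem hv).1
      simp at this
  · ext i
    rw [chainOfTiling, if_pos le_rfl, mem_freeEdges, mem_edges, Finset.mem_Ico]
    constructor
    · rintro ⟨h, -⟩
      push_cast at h
      omega
    · intro h
      refine ⟨by push_cast; omega, fun hv => ?_⟩
      have := (hT.vertical_mem hv).2.1
      simp at this
  · rw [chainOfTiling, chainOfTiling, if_pos hr.le, if_pos (Nat.succ_le_of_lt hr)]
    exact hT.step hr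
  · rw [chainOfTiling, if_neg (by omega)]

/-- The tiling with given sets of free edges.  The `j`-th free edge of a line and the `j`-th free
edge of the next line are opposite sides of a left or right lozenge. -/
def tilingOfChain (a b c : ℕ) (F : ℕ → Finset ℤ) : Set Lozenge :=
  {L | match L with
    | .vertical i r => 0 ≤ r ∧ r ≤ a + c ∧ i ∈ edges a b c r.toNat ∧ i ∉ F r.toNat
    | .left i r => 0 ≤ r ∧ r < a + c ∧ i - 1 ∈ F r.toNat ∧ i ∈ F (r.toNat + 1) ∧
        below (F r.toNat) (i - 1) = below (F (r.toNat + 1)) i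
    | .right i r => 0 ≤ r ∧ r < a + c ∧ i ∈ F r.toNat ∧ i ∈ F (r.toNat + 1) ∧
        below (F r.toNat) i = below (F (r.toNat + 1)) i}

theorem vertical_mem_tilingOfChain {a b c : ℕ} {F : ℕ → Finset ℤ} {i r : ℤ} :
    Lozenge.vertical i r ∈ tilingOfChain a b c F ↔
      0 ≤ r ∧ r ≤ a + c ∧ i ∈ edges a b c r.toNat ∧ i ∉ F r.toNat := Iff.rfl

theorem left_mem_tilingOfChain {a b c : ℕ} {F : ℕ → Finset ℤ} {i r : ℤ} :
    Lozenge.left i r ∈ tilingOfChain a b c F ↔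
      0 ≤ r ∧ r < a + c ∧ i - 1 ∈ F r.toNat ∧ i ∈ F (r.toNat + 1) ∧
        below (F r.toNat) (i - 1) = below (F (r.toNat + 1)) i := Iff.rfl

theorem right_mem_tilingOfChain {a b c : ℕ} {F : ℕ → Finset ℤ} {i r : ℤ} :
    Lozenge.right i r ∈ tilingOfChain a b c F ↔
      0 ≤ r ∧ r < a + c ∧ i ∈ F r.toNat ∧ i ∈ F (r.toNat + 1) ∧
        below (F r.toNat) i = below (F (r.toNat + 1)) i := Iff.rfl

section OfChain

variable {a b c : ℕ} {F : ℕ → Finset ℤ}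
  (hF : F ∈ Chains (a + c) (Finset.Ico 0 (b : ℤ)) (Finset.Ico (c : ℤ) (b + c)))

include hF

/-- The shape of the hexagon need not be imposed on the particles: it follows from their first and
last configurations. -/
theorem chain_subset_edges {r : ℕ} (hr : r ≤ a + c) : F r ⊆ edges a b c r := by
  intro i hi
  have h1 := Finset.mem_Ico.1 (Chains.subset_Ico hF subset_rfl hr hi)
  have h2 := Chains.subset_Ico' hF subset_rfl (Nat.sub_le (a + c) r)
  rw [show a + c - (a + c - r) = r by omega] at h2
  have h3 := Finset.mem_Ico.1 (h2 hi)
  rw [mem_edges]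
  omega

theorem chain_zero : F 0 = edges a b c 0 := by
  rw [hF.1]
  ext i
  rw [mem_edges, Finset.mem_Ico]
  push_cast
  omega

theorem chain_last : F (a + c) = edges a b c (a + c) := by
  rw [hF.2.1]
  ext i
  rw [mem_edges, Finset.mem_Ico]
  push_cast
  omega

/-- Both triangles at an edge that is not free are covered by a vertical lozenge.  For a free edge,
the particle with the same index on the neighbouring line is at one of two places, which decides
between the left and the right lozenge. -/
theorem isTiling_tilingOfChain : IsTiling a b c (tilingOfChain a b c F) := by
  have hsub : ∀ {r : ℕ}, (r : ℤ) ≤ a + c → F r ⊆ edges a b c r := fun h =>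
    chain_subset_edges hF (by omega)
  constructor
  · intro L hL
    cases L with
    | vertical i r =>
      obtain ⟨h0, h1, h2, h3⟩ := vertical_mem_tilingOfChain.1 hL
      -- All edges of the top and bottom lines are free, so a vertical lozenge cannot stick out.
      have hr0 : r ≠ 0 := by
        rintro rfl
        exact h3 (chain_zero hF ▸ h2)
      have hr1 : r ≠ a + c := by
        rintro rfl
        have h4 : ((a : ℤ) + c).toNat = a + c := by omega
        rw [h4] at h2 h3
        exact h3 (chain_last hF ▸ h2)
      refine vertical_triangles_subset.2 ⟨up_mem_hexagon.2 ⟨by omega, by omega, ?_⟩,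
        down_mem_hexagon.2 ⟨h0, by omega, h2⟩⟩
      rwa [show (r - 1).toNat + 1 = r.toNat by omega]
    | left i r =>
      obtain ⟨h0, h1, h2, h3, -⟩ := left_mem_tilingOfChain.1 hL
      exact left_triangles_subset.2
        ⟨up_mem_hexagon.2 ⟨h0, h1, hsub (by omega) h3⟩,
          down_mem_hexagon.2 ⟨h0, h1, hsub (by omega) h2⟩⟩
    | right i r =>
      obtain ⟨h0, h1, h2, h3, -⟩ := right_mem_tilingOfChain.1 hL
      exact right_triangles_subset.2
        ⟨up_mem_hexagon.2 ⟨h0, h1, hsub (by omega) h3⟩,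
          down_mem_hexagon.2 ⟨h0, h1, hsub (by omega) h2⟩⟩
  · intro t ht
    cases t with
    | up i r =>
      obtain ⟨hr0, hr1, hi⟩ := up_mem_hexagon.1 ht
      obtain ⟨s, rfl⟩ := Int.eq_ofNat_of_zero_le hr0
      rw [Int.toNat_natCast] at hi
      have hs := hF.2.2.1 s (by omega)
      have e1 := hs i
      have e2 := hs (i - 1)
      have e3 := hs (i + 1)
      have b1 := below_add_one (F s) i
      have b2 := below_add_one (F s) (i - 1)
      have b3 := below_add_one (F (s + 1)) i
      rw [sub_add_cancel] at e2 b2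
      by_cases hf : i ∈ F (s + 1)
      · rw [if_pos hf] at b3
        by_cases hb : below (F s) i = below (F (s + 1)) i
        · have h3 : i ∈ F s := by
            by_contra h3
            rw [if_neg h3] at b1
            omega
          refine ⟨.right i s, ⟨right_mem_tilingOfChain.2 ⟨hr0, hr1, ?_⟩,
            up_mem_right.2 ⟨rfl, rfl⟩⟩, ?_⟩
          · rw [Int.toNat_natCast]
            exact ⟨h3, hf, hb⟩
          · rintro (⟨j, u⟩ | ⟨j, u⟩ | ⟨j, u⟩) ⟨hL, hm⟩
            · obtain ⟨rfl, h⟩ := up_mem_vertical.1 hm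
              obtain rfl : u = ((s + 1 : ℕ) : ℤ) := by push_cast; omega
              have := (vertical_mem_tilingOfChain.1 hL).2.2.2
              rw [Int.toNat_natCast] at this
              exact absurd hf this
            · obtain ⟨rfl, rfl⟩ := up_mem_left.1 hm
              obtain ⟨-, -, h4, -, h5⟩ := left_mem_tilingOfChain.1 hL
              rw [Int.toNat_natCast] at h4 h5
              rw [if_pos h4] at b2
              omega
            · obtain ⟨rfl, rfl⟩ := up_mem_right.1 hm
              rfl
        · have h3 : i - 1 ∈ F s := by
            by_contra h3
            rw [if_neg h3] at b2
            omega
          rw [if_pos h3] at b2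
          refine ⟨.left i s, ⟨left_mem_tilingOfChain.2 ⟨hr0, hr1, ?_⟩,
            up_mem_left.2 ⟨rfl, rfl⟩⟩, ?_⟩
          · rw [Int.toNat_natCast]
            exact ⟨h3, hf, by omega⟩
          · rintro (⟨j, u⟩ | ⟨j, u⟩ | ⟨j, u⟩) ⟨hL, hm⟩
            · obtain ⟨rfl, h⟩ := up_mem_vertical.1 hm
              obtain rfl : u = ((s + 1 : ℕ) : ℤ) := by push_cast; omega
              have := (vertical_mem_tilingOfChain.1 hL).2.2.2
              rw [Int.toNat_natCast] at this
              exact absurd hf this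
            · obtain ⟨rfl, rfl⟩ := up_mem_left.1 hm
              rfl
            · obtain ⟨rfl, rfl⟩ := up_mem_right.1 hm
              obtain ⟨-, -, -, -, h5⟩ := right_mem_tilingOfChain.1 hL
              rw [Int.toNat_natCast] at h5
              exact absurd h5 hb
      · refine ⟨.vertical i (s + 1 : ℕ), ⟨vertical_mem_tilingOfChain.2 ⟨by omega, ?_, ?_⟩,
          up_mem_vertical.2 ⟨rfl, by push_cast; omega⟩⟩, ?_⟩
        · push_cast
          omega
        · rw [Int.toNat_natCast]
          exact ⟨hi, hf⟩
        · rintro (⟨j, u⟩ | ⟨j, u⟩ | ⟨j, u⟩) ⟨hL, hm⟩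
          · obtain ⟨rfl, h⟩ := up_mem_vertical.1 hm
            obtain rfl : u = ((s + 1 : ℕ) : ℤ) := by push_cast; omega
            rfl
          · obtain ⟨rfl, rfl⟩ := up_mem_left.1 hm
            exact absurd (left_mem_tilingOfChain.1 hL).2.2.2.1 (by rwa [Int.toNat_natCast])
          · obtain ⟨rfl, rfl⟩ := up_mem_right.1 hm
            exact absurd (right_mem_tilingOfChain.1 hL).2.2.2.1 (by rwa [Int.toNat_natCast])
    | down i r =>
      obtain ⟨hr0, hr1, hi⟩ := down_mem_hexagon.1 ht
      obtain ⟨s, rfl⟩ := Int.eq_ofNat_of_zero_le hr0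
      rw [Int.toNat_natCast] at hi
      have hs := hF.2.2.1 s (by omega)
      have e1 := hs i
      have e2 := hs (i + 1)
      have b1 := below_add_one (F s) i
      have b2 := below_add_one (F (s + 1)) (i + 1)
      have b3 := below_add_one (F (s + 1)) i
      by_cases hf : i ∈ F s
      · rw [if_pos hf] at b1
        by_cases hb : below (F (s + 1)) (i + 1) = below (F s) i
        · have h3 : i + 1 ∈ F (s + 1) := by
            by_contra h3
            rw [if_neg h3] at b2
            omega
          refine ⟨.left (i + 1) s, ⟨left_mem_tilingOfChain.2 ⟨hr0, hr1, ?_⟩,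
            down_mem_left.2 ⟨by omega, rfl⟩⟩, ?_⟩
          · rw [Int.toNat_natCast, add_sub_cancel_right]
            exact ⟨hf, h3, hb.symm⟩
          · rintro (⟨j, u⟩ | ⟨j, u⟩ | ⟨j, u⟩) ⟨hL, hm⟩
            · obtain ⟨rfl, rfl⟩ := down_mem_vertical.1 hm
              have := (vertical_mem_tilingOfChain.1 hL).2.2.2
              rw [Int.toNat_natCast] at this
              exact absurd hf this
            · obtain ⟨h, rfl⟩ := down_mem_left.1 hm
              obtain rfl : j = i + 1 := by omega
              rfl
            · obtain ⟨rfl, rfl⟩ := down_mem_right.1 hm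
              obtain ⟨-, -, -, h4, h5⟩ := right_mem_tilingOfChain.1 hL
              rw [Int.toNat_natCast] at h4 h5
              rw [if_pos h4] at b3
              omega
        · have h3 : i ∈ F (s + 1) := by
            by_contra h3
            rw [if_neg h3] at b3
            omega
          rw [if_pos h3] at b3
          refine ⟨.right i s, ⟨right_mem_tilingOfChain.2 ⟨hr0, hr1, ?_⟩,
            down_mem_right.2 ⟨rfl, rfl⟩⟩, ?_⟩
          · rw [Int.toNat_natCast]
            exact ⟨hf, h3, by split_ifs at b2 <;> omega⟩
          · rintro (⟨j, u⟩ | ⟨j, u⟩ | ⟨j, u⟩) ⟨hL, hm⟩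
            · obtain ⟨rfl, rfl⟩ := down_mem_vertical.1 hm
              have := (vertical_mem_tilingOfChain.1 hL).2.2.2
              rw [Int.toNat_natCast] at this
              exact absurd hf this
            · obtain ⟨h, rfl⟩ := down_mem_left.1 hm
              obtain rfl : j = i + 1 := by omega
              obtain ⟨-, -, -, -, h5⟩ := left_mem_tilingOfChain.1 hL
              rw [Int.toNat_natCast, add_sub_cancel_right] at h5
              exact absurd h5.symm hb
            · obtain ⟨rfl, rfl⟩ := down_mem_right.1 hm
              rfl
      · refine ⟨.vertical i s, ⟨vertical_mem_tilingOfChain.2 ⟨hr0, hr1.le, ?_⟩,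
          down_mem_vertical.2 ⟨rfl, rfl⟩⟩, ?_⟩
        · rw [Int.toNat_natCast]
          exact ⟨hi, hf⟩
        · rintro (⟨j, u⟩ | ⟨j, u⟩ | ⟨j, u⟩) ⟨hL, hm⟩
          · obtain ⟨rfl, rfl⟩ := down_mem_vertical.1 hm
            rfl
          · obtain ⟨rfl, rfl⟩ := down_mem_left.1 hm
            exact absurd (left_mem_tilingOfChain.1 hL).2.2.1 (by rwa [Int.toNat_natCast])
          · obtain ⟨rfl, rfl⟩ := down_mem_right.1 hm
            exact absurd (right_mem_tilingOfChain.1 hL).2.2.1 (by rwa [Int.toNat_natCast])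

theorem chainOfTiling_tilingOfChain : chainOfTiling a b c (tilingOfChain a b c F) = F := by
  funext r
  rw [chainOfTiling]
  split_ifs with hr
  · ext i
    rw [mem_freeEdges, vertical_mem_tilingOfChain, Int.toNat_natCast]
    constructor
    · rintro ⟨h1, h2⟩
      by_contra h3
      exact h2 ⟨by omega, by omega, h1, h3⟩
    · intro h
      exact ⟨chain_subset_edges hF hr h, fun h' => h'.2.2.2 h⟩
  · rw [hF.2.2.2 r (by omega)]

end OfChain

theorem IsTiling.tilingOfChain_chainOfTiling {a b c : ℕ} {T : Set Lozenge}
    (hT : IsTiling a b c T) : tilingOfChain a b c (chainOfTiling a b c T) = T := by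
  refine (hT.eq_of_subset (isTiling_tilingOfChain hT.chainOfTiling_mem) ?_).symm
  have hc : ∀ {r : ℤ}, r ≤ a + c → chainOfTiling a b c T r.toNat = freeEdges a b c T r.toNat :=
    fun h => if_pos (by omega)
  have hc' : ∀ {r : ℤ}, 0 ≤ r → r < a + c →
      chainOfTiling a b c T (r.toNat + 1) = freeEdges a b c T (r.toNat + 1) :=
    fun h h' => if_pos (by omega)
  intro L hL
  cases L with
  | vertical i r =>
    have h := hT.vertical_mem hL
    refine vertical_mem_tilingOfChain.2 ⟨by omega, by omega, h.2.2, ?_⟩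
    rw [hc (by omega), mem_freeEdges]
    rintro ⟨-, h'⟩
    rw [Int.toNat_of_nonneg (by omega)] at h'
    exact h' hL
  | left i r =>
    obtain ⟨h0, h1, h2, h3⟩ := hT.left_mem hL
    refine left_mem_tilingOfChain.2 ⟨h0, h1, ?_⟩
    rw [hc h1.le, hc' h0 h1]
    exact ⟨h2, h3, hT.below_eq_of_left_mem (by omega) (by rwa [Int.toNat_of_nonneg h0])⟩
  | right i r =>
    obtain ⟨h0, h1, h2, h3⟩ := hT.right_mem hL
    refine right_mem_tilingOfChain.2 ⟨h0, h1, ?_⟩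
    rw [hc h1.le, hc' h0 h1]
    exact ⟨h2, h3, hT.below_eq_of_right_mem (by omega) (by rwa [Int.toNat_of_nonneg h0])⟩

/-- The edges of the `k`-th line that are free when the vertical lozenges on this line are at the
hexagonal positions in `S`. -/
noncomputable def freeEdgesOfPositions (a b c k : ℕ) (S : Finset ℤ) : Finset ℤ :=
  (edges a b c k).filter (fun i => i + 1 - leftBorder a k ∉ S)

theorem IsTiling.positions_eq_iff {a b c k n : ℕ} {T : Set Lozenge} (hT : IsTiling a b c T)
    {S : Finset ℤ} (hS : S ⊆ Finset.Icc 1 (n : ℤ))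
    (hn : leftBorder a k + n = min ((b : ℤ) + c) (b + k)) :
    positions a k T = ↑S ↔ freeEdges a b c T k = freeEdgesOfPositions a b c k S := by
  have hv : ∀ {i : ℤ}, Lozenge.vertical i k ∈ T → i ∈ edges a b c k := fun h => by
    simpa using (hT.vertical_mem h).2.2
  have hp : ∀ i : ℤ, i + 1 - leftBorder a k ∈ positions a k T ↔ Lozenge.vertical i k ∈ T := by
    intro i
    constructor
    · rintro ⟨j, hj, h⟩
      obtain rfl : i = j := by omega
      exact hj
    · intro h
      exact ⟨i, h, rfl⟩
  constructor
  · intro h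
    ext i
    rw [mem_freeEdges, freeEdgesOfPositions, Finset.mem_filter, ← hp, h, Finset.mem_coe]
  · intro h
    have h' : ∀ i, i ∈ edges a b c k →
        (Lozenge.vertical i k ∈ T ↔ i + 1 - leftBorder a k ∈ S) := by
      intro i hi
      have := Finset.ext_iff.1 h i
      rw [mem_freeEdges, freeEdgesOfPositions, Finset.mem_filter] at this
      tauto
    ext p
    obtain ⟨i, rfl⟩ : ∃ i, p = i + 1 - leftBorder a k := ⟨p - 1 + leftBorder a k, by ring⟩
    rw [hp, Finset.mem_coe]
    constructor
    · intro hi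
      exact (h' i (hv hi)).1 hi
    · intro hi
      refine (h' i ?_).2 hi
      have := Finset.mem_Icc.1 (hS hi)
      rw [edges, Finset.mem_Ico]
      omega

/-- Rotating the part of the hexagon below the `k`-th line by `π` makes it start, like the part
above, with `b` adjacent free edges. -/
theorem numTilings_eq_mul {a b c k n : ℕ} (hk : k ≤ a + c) {S : Finset ℤ}
    (hS : S ⊆ Finset.Icc 1 (n : ℤ)) (hn : leftBorder a k + n = min ((b : ℤ) + c) (b + k)) :
    numTilings a b c k S
      = (Chains k (Finset.Ico 0 (b : ℤ)) (freeEdgesOfPositions a b c k S)).ncard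
        * (Chains (a + c - k) (Finset.Ico 0 (b : ℤ))
            (reflect (b + c - 1) (freeEdgesOfPositions a b c k S))).ncard := by
  have h1 : reflect (b + c - 1) (Finset.Ico (c : ℤ) (b + c)) = Finset.Ico 0 (b : ℤ) := by
    ext i
    rw [mem_reflect, Finset.mem_Ico, Finset.mem_Ico]
    omega
  rw [← h1, ← ncard_chains_reflect, h1, ← ncard_chains_through,
    show k + (a + c - k) = a + c by omega, numTilings]
  refine Set.ncard_congr (fun T _ => chainOfTiling a b c T) ?_ ?_ ?_
  · rintro T ⟨hT, hp⟩
    refine ⟨hT.chainOfTiling_mem, ?_⟩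
    rw [chainOfTiling, if_pos hk]
    exact (hT.positions_eq_iff hS hn).1 hp
  · rintro T T' ⟨hT, -⟩ ⟨hT', -⟩ h
    rw [← hT.tilingOfChain_chainOfTiling, ← hT'.tilingOfChain_chainOfTiling, h]
  · rintro F ⟨hF, hFk⟩
    have hT := isTiling_tilingOfChain hF
    refine ⟨tilingOfChain a b c F, ⟨hT, (hT.positions_eq_iff hS hn).2 ?_⟩,
      chainOfTiling_tilingOfChain hF⟩
    rw [← hFk]
    have := congrFun (chainOfTiling_tilingOfChain hF) k
    rwa [chainOfTiling, if_pos hk] at this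

/-! ### The logarithm of the number of tilings -/

/-- The sum of `log |s - t|` over all ordered pairs of elements of `X`; the pairs with `s = t`
contribute `log 0 = 0`. -/
noncomputable def logEnergy (X : Finset ℤ) : ℝ :=
  ∑ s ∈ X, ∑ t ∈ X, Real.log ((s : ℝ) - t)

theorem log_sub_comm (x y : ℝ) : Real.log (x - y) = Real.log (y - x) := by
  rw [← Real.log_neg_eq_log, neg_sub]

theorem logEnergy_image {f : ℤ → ℤ} (hf : ∀ s t, f s - f t = s - t ∨ f s - f t = t - s)
    (X : Finset ℤ) : logEnergy (X.image f) = logEnergy X := by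
  have hinj : Function.Injective f := fun s t h => by
    rcases hf s t with h' | h' <;> omega
  rw [logEnergy, logEnergy, Finset.sum_image hinj.injOn]
  refine Finset.sum_congr rfl fun s _ => ?_
  rw [Finset.sum_image hinj.injOn]
  refine Finset.sum_congr rfl fun t _ => ?_
  rcases hf s t with h | h
  · rw [← Int.cast_sub, h, Int.cast_sub]
  · rw [← Int.cast_sub, h, Int.cast_sub, log_sub_comm]

theorem log_det_vandermonde {m : ℕ} {q : Fin m → ℤ} (hq : Function.Injective q) :
    Real.log (((Matrix.vandermonde q).det : ℤ) : ℝ)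
      = (∑ i, ∑ j, Real.log ((q i : ℝ) - q j)) / 2 := by
  have hne : ∀ i, ∀ j ∈ Finset.Ioi i, ((q j : ℝ) - q i) ≠ 0 := by
    intro i j hj
    rw [sub_ne_zero]
    exact fun h => (Finset.mem_Ioi.1 hj).ne (hq (Int.cast_injective h)).symm
  rw [Matrix.det_vandermonde]
  push_cast
  rw [Real.log_prod (fun i _ => Finset.prod_ne_zero_iff.2 (hne i))]
  have h1 : ∀ i, Real.log (∏ j ∈ Finset.Ioi i, ((q j : ℝ) - q i))
      = ∑ j ∈ Finset.Ioi i, Real.log ((q i : ℝ) - q j) := by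
    intro i
    rw [Real.log_prod (hne i)]
    exact Finset.sum_congr rfl fun j _ => log_sub_comm _ _
  rw [Finset.sum_congr rfl fun i _ => h1 i]
  have h2 : ∀ i, ∑ j, Real.log ((q i : ℝ) - q j)
      = ∑ j ∈ Finset.Ioi i, Real.log ((q i : ℝ) - q j)
        + ∑ j ∈ Finset.Iio i, Real.log ((q i : ℝ) - q j) := by
    intro i
    rw [← Finset.sum_filter_add_sum_filter_not Finset.univ (fun j => i < j)]
    have e1 : Finset.univ.filter (fun j => i < j) = Finset.Ioi i := by ext; simp
    have e2 : Finset.univ.filter (fun j => ¬ i < j) = insert i (Finset.Iio i) := by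
      ext j
      simp [le_iff_eq_or_lt]
    rw [e1, e2, Finset.sum_insert (by simp)]
    simp
  have h3 : ∑ i : Fin m, ∑ j ∈ Finset.Iio i, Real.log ((q i : ℝ) - q j)
      = ∑ i : Fin m, ∑ j ∈ Finset.Ioi i, Real.log ((q i : ℝ) - q j) := by
    rw [Finset.sum_comm' (t' := Finset.univ) (s' := fun j => Finset.Ioi j)
      (by intro x y; simp)]
    exact Finset.sum_congr rfl fun i _ => Finset.sum_congr rfl fun j _ => log_sub_comm _ _
  rw [Finset.sum_congr rfl fun i _ => h2 i, Finset.sum_add_distrib, h3]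
  ring

/-- Half the logarithmic energy is the logarithm of the Vandermonde product. -/
theorem log_patternCount {X : Finset ℤ} {m : ℕ} (hX : X.card = m) :
    Real.log (patternCount X) = logEnergy X / 2 - logEnergy (Finset.Ico 0 (m : ℤ)) / 2 := by
  have hinj := (X.orderEmbOfFin hX).injective
  have hid : Function.Injective (fun i : Fin m => ((i : ℕ) : ℤ)) := fun i j h => by
    simpa [Fin.ext_iff] using h
  have h1 := binomDet_mul_det_vandermonde_id (X.orderEmbOfFin hX)
  have h2 := Matrix.det_vandermonde_ne_zero_iff.2 hinj
  rw [← h1] at h2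
  have h3 : Real.log (((Matrix.vandermonde (X.orderEmbOfFin hX)).det : ℤ) : ℝ)
      = Real.log (patternCount X)
        + Real.log (((Matrix.vandermonde fun i : Fin m => (i : ℤ)).det : ℤ) : ℝ) := by
    rw [← h1, Int.cast_mul, Real.log_mul, patternCount_eq hX]
    · exact_mod_cast left_ne_zero_of_mul h2
    · exact_mod_cast right_ne_zero_of_mul h2
  rw [log_det_vandermonde hinj, log_det_vandermonde hid] at h3
  have h4 : ∑ i, ∑ j, Real.log ((X.orderEmbOfFin hX i : ℝ) - X.orderEmbOfFin hX j)
      = logEnergy X := by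
    have e : logEnergy X = logEnergy (Finset.univ.image (X.orderEmbOfFin hX)) := by
      rw [Finset.image_orderEmbOfFin_univ]
    rw [e, logEnergy, Finset.sum_image hinj.injOn]
    refine Finset.sum_congr rfl fun i _ => ?_
    rw [Finset.sum_image hinj.injOn]
  have h5 : ∑ i : Fin m, ∑ j : Fin m, Real.log ((((i : ℕ) : ℤ) : ℝ) - (((j : ℕ) : ℤ) : ℝ))
      = logEnergy (Finset.Ico 0 (m : ℤ)) := by
    have e : Finset.Ico 0 (m : ℤ) = Finset.univ.image (fun i : Fin m => ((i : ℕ) : ℤ)) := by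
      ext t
      simp only [Finset.mem_Ico, Finset.mem_image, Finset.mem_univ, true_and]
      constructor
      · intro h
        exact ⟨⟨t.toNat, by omega⟩, by simp only; omega⟩
      · rintro ⟨i, rfl⟩
        omega
    rw [e, logEnergy, Finset.sum_image hid.injOn]
    refine Finset.sum_congr rfl fun i _ => ?_
    rw [Finset.sum_image hid.injOn]
  rw [h4, h5] at h3
  linarith

/-- The positions in `S ⊆ {1, …, n}`, together with the `x` positions just before `1` and the `y`
positions just after `n`. -/
noncomputable def dents (n : ℕ) (S : Finset ℤ) (x y : ℕ) : Finset ℤ :=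
  S ∪ (Finset.Icc (1 - (x : ℤ)) 0 ∪ Finset.Icc ((n : ℤ) + 1) (n + y))

theorem mem_dents {n : ℕ} {S : Finset ℤ} {x y : ℕ} {t : ℤ} : t ∈ dents n S x y ↔
    t ∈ S ∨ (1 - (x : ℤ) ≤ t ∧ t ≤ 0) ∨ ((n : ℤ) + 1 ≤ t ∧ t ≤ n + y) := by
  simp [dents]

/-- The lozenge tilings on either side of the `k`-th line are counted separately, each side being
completed to a trapezoid by dents.  The subtractions are truncated: there are dents above the line
on the left if `a < k`, below it if `k < a`, and similarly for `c` on the right. -/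
theorem log_numTilings {a b c k n : ℕ} (hk : 2 * k ≤ a + c) (hn : n = b + min k (min a c))
    {S : Finset ℤ} (hS : S ⊆ Finset.Icc 1 (n : ℤ)) (hSc : S.card = min k (min a c)) :
    Real.log (numTilings a b c k S)
      = logEnergy (dents n S (k - a) (k - c)) / 2 + logEnergy (dents n S (a - k) (c - k)) / 2
        - logEnergy (Finset.Ico 0 (k : ℤ)) / 2
        - logEnergy (Finset.Ico 0 ((a + c - k : ℕ) : ℤ)) / 2 := by
  have hlb : leftBorder a k + n = min ((b : ℤ) + c) (b + k) := by
    rw [leftBorder]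
    omega
  have hl : leftBorder a k = max 0 ((k : ℤ) - a) := rfl
  set H := freeEdgesOfPositions a b c k S with hH
  have hmem : ∀ i, i ∈ H ↔ i ∈ edges a b c k ∧ i + 1 - leftBorder a k ∉ S := by
    intro i
    rw [hH, freeEdgesOfPositions, Finset.mem_filter]
  have hcard : H.card = b := by
    have h1 : H = edges a b c k \ S.image (fun p => p - 1 + leftBorder a k) := by
      ext i
      rw [hmem, Finset.mem_sdiff, Finset.mem_image]
      refine and_congr_right fun _ => not_congr ⟨fun h => ⟨_, h, by ring⟩, ?_⟩
      rintro ⟨p, hp, rfl⟩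
      rwa [show p - 1 + leftBorder a k + 1 - leftBorder a k = p by ring]
    have h2 : S.image (fun p => p - 1 + leftBorder a k) ⊆ edges a b c k := by
      intro i hi
      obtain ⟨p, hp, rfl⟩ := Finset.mem_image.1 hi
      have := Finset.mem_Icc.1 (hS hp)
      rw [edges, Finset.mem_Ico]
      omega
    rw [h1, Finset.card_sdiff_of_subset h2,
      Finset.card_image_of_injective _ (fun p p' h => by simpa using h), hSc, edges, Int.card_Ico]
    omega
  have hsub : H ⊆ Finset.Ico 0 ((b : ℤ) + k) := by
    intro i hi
    have := mem_edges.1 ((hmem i).1 hi).1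
    rw [Finset.mem_Ico]
    omega
  have hsub' : reflect (b + c - 1) H ⊆ Finset.Ico 0 ((b : ℤ) + (a + c - k : ℕ)) := by
    intro i hi
    have := mem_edges.1 ((hmem _).1 (mem_reflect.1 hi)).1
    rw [Finset.mem_Ico]
    omega
  have hcard' : (reflect (b + c - 1) H).card = b := by rw [card_reflect, hcard]
  have h1 := ncard_chains_eq_patternCount hsub hcard
  have h2 := ncard_chains_eq_patternCount hsub' hcard'
  have c1 := card_Ico_sdiff hsub hcard
  have c2 := card_Ico_sdiff hsub' hcard'
  have l1 := log_patternCount c1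
  have l2 := log_patternCount c2
  -- The sites without particles, measured from the left border, are the dents; below the line they
  -- have to be reflected back first.
  have e1 : dents n S (k - a) (k - c)
      = (Finset.Ico 0 ((b : ℤ) + k) \ H).image (fun i => i + 1 - leftBorder a k) := by
    ext t
    rw [mem_dents, Finset.mem_image]
    constructor
    · intro h
      refine ⟨t - 1 + leftBorder a k, ?_, by ring⟩
      rw [Finset.mem_sdiff, Finset.mem_Ico, hmem, mem_edges,
        show t - 1 + leftBorder a k + 1 - leftBorder a k = t by ring]
      have hb := @hS t
      rw [Finset.mem_Icc] at hb
      by_cases ht : t ∈ S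
      · have := hb ht
        exact ⟨by omega, fun h' => h'.2 ht⟩
      · have h' := h.resolve_left ht
        refine ⟨by omega, fun h'' => ?_⟩
        have := h''.1
        omega
    · rintro ⟨i, hi, rfl⟩
      rw [Finset.mem_sdiff, Finset.mem_Ico, hmem, mem_edges] at hi
      by_cases ht : i + 1 - leftBorder a k ∈ S
      · exact Or.inl ht
      · right
        have hi2 : ¬ (0 ≤ i ∧ (k : ℤ) - a ≤ i ∧ i < (b : ℤ) + c ∧ i < (b : ℤ) + k) :=
          fun h => hi.2 ⟨h, ht⟩
        omega
  have e2 : dents n S (a - k) (c - k)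
      = (Finset.Ico 0 ((b : ℤ) + (a + c - k : ℕ)) \ reflect (b + c - 1) H).image
          (fun i => b + c - leftBorder a k - i) := by
    ext t
    rw [mem_dents, Finset.mem_image]
    constructor
    · intro h
      refine ⟨b + c - leftBorder a k - t, ?_, by ring⟩
      rw [Finset.mem_sdiff, Finset.mem_Ico, mem_reflect, hmem, mem_edges,
        show (b : ℤ) + c - 1 - (b + c - leftBorder a k - t) + 1 - leftBorder a k = t by ring]
      have hb := @hS t
      rw [Finset.mem_Icc] at hb
      by_cases ht : t ∈ S
      · have := hb ht
        exact ⟨by omega, fun h' => h'.2 ht⟩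
      · have h' := h.resolve_left ht
        refine ⟨by omega, fun h'' => ?_⟩
        have := h''.1
        omega
    · rintro ⟨i, hi, rfl⟩
      rw [Finset.mem_sdiff, Finset.mem_Ico, mem_reflect, hmem, mem_edges,
        show (b : ℤ) + c - 1 - i + 1 - leftBorder a k = b + c - leftBorder a k - i by ring] at hi
      by_cases ht : (b : ℤ) + c - leftBorder a k - i ∈ S
      · exact Or.inl ht
      · right
        have hi2 : ¬ (0 ≤ (b : ℤ) + c - 1 - i ∧ (k : ℤ) - a ≤ (b : ℤ) + c - 1 - i ∧
            (b : ℤ) + c - 1 - i < (b : ℤ) + c ∧ (b : ℤ) + c - 1 - i < (b : ℤ) + k) :=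
          fun h => hi.2 ⟨h, ht⟩
        omega
  rw [e1, e2, logEnergy_image fun s t => Or.inl (by ring),
    logEnergy_image fun s t => Or.inr (by ring), numTilings_eq_mul (by omega) hS hlb]
  have n1 : ((Chains k (Finset.Ico 0 (b : ℤ)) H).ncard : ℝ)
      = patternCount (Finset.Ico 0 ((b : ℤ) + k) \ H) := by exact_mod_cast congrArg Int.cast h1
  have n2 : ((Chains (a + c - k) (Finset.Ico 0 (b : ℤ)) (reflect (b + c - 1) H)).ncard : ℝ)
      = patternCount (Finset.Ico 0 ((b : ℤ) + (a + c - k : ℕ)) \ reflect (b + c - 1) H) := by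
    exact_mod_cast congrArg Int.cast h2
  have p0 : ∀ {X : Finset ℤ}, (patternCount X : ℝ) ≠ 0 := by
    intro X
    have h3 := binomDet_mul_det_vandermonde_id (X.orderEmbOfFin rfl)
    have h4 := Matrix.det_vandermonde_ne_zero_iff.2 (X.orderEmbOfFin rfl).injective
    rw [← h3] at h4
    exact_mod_cast left_ne_zero_of_mul h4
  rw [Nat.cast_mul, n1, n2, Real.log_mul p0 p0, l1, l2]
  ring

/-! ### Averages of the logarithm over pairs of cells -/

/-- A second antiderivative of the logarithm. -/
noncomputable def logPrim (x : ℝ) : ℝ := x ^ 2 / 2 * Real.log x - 3 / 4 * x ^ 2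

/-- The second difference of `logPrim`, which is the mean of `log |x - y|` over `x` in the
unit interval `[d, d + 1]` and `y` in `[0, 1]`. -/
noncomputable def meanLog (d : ℝ) : ℝ := logPrim (d + 1) + logPrim (d - 1) - 2 * logPrim d

theorem logPrim_neg (x : ℝ) : logPrim (-x) = logPrim x := by
  simp [logPrim, Real.log_neg_eq_log]

theorem logPrim_zero : logPrim 0 = 0 := by simp [logPrim]

theorem continuous_logPrim : Continuous logPrim := by
  have h : logPrim = fun x : ℝ => x / 2 * (x * Real.log x) - 3 / 4 * x ^ 2 := by
    funext x
    rw [logPrim]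
    ring
  rw [h]
  exact ((continuous_id.div_const 2).mul Real.continuous_mul_log).sub (by fun_prop)

theorem meanLog_neg (d : ℝ) : meanLog (-d) = meanLog d := by
  rw [meanLog, meanLog, logPrim_neg, show -d + 1 = -(d - 1) by ring,
    show -d - 1 = -(d + 1) by ring, logPrim_neg, logPrim_neg]
  ring

/-- Scaling by `n` changes `logPrim` by a multiple of `log n`. -/
theorem logPrim_div {n : ℝ} (hn : n ≠ 0) (x : ℝ) :
    n ^ 2 * logPrim (x / n) = logPrim x - x ^ 2 / 2 * Real.log n := by
  by_cases hx : x = 0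
  · simp [hx, logPrim]
  · rw [logPrim, logPrim, Real.log_div hx hn]
    field_simp
    ring

/-- With `u = log (1 - 1 / d)` and `v = log (1 + 1 / d)` the difference is a combination of `u`
and `v` in which the second order Taylor polynomials cancel up to `-1 / (2 * d ^ 2)`. -/
theorem abs_meanLog_sub_log_le_of_two_le {d : ℝ} (hd : 2 ≤ d) :
    |meanLog d - Real.log d| ≤ 6 / (d + 1) := by
  have hd0 : 0 < d := by linarith
  have hx : |1 / d| < 1 := by
    rw [abs_of_pos (by positivity), div_lt_one hd0]
    linarith
  have hx' : |-(1 / d)| < 1 := by rwa [abs_neg]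
  have h1 := Real.abs_log_sub_add_sum_range_le hx 2
  have h2 := Real.abs_log_sub_add_sum_range_le hx' 2
  rw [abs_neg] at h2
  simp only [Finset.sum_range_succ, Finset.sum_range_zero,
    abs_of_pos (show 0 < 1 / d by positivity)] at h1 h2
  have l1 : Real.log (d + 1) = Real.log d + Real.log (1 - -(1 / d)) := by
    rw [← Real.log_mul hd0.ne' (by rw [sub_neg_eq_add]; positivity)]
    congr 1
    field_simp
    ring
  have l2 : Real.log (d - 1) = Real.log d + Real.log (1 - 1 / d) := by
    have : (1 - 1 / d) ≠ 0 := by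
      rw [sub_ne_zero, ne_eq, eq_div_iff hd0.ne']
      linarith
    rw [← Real.log_mul hd0.ne' this]
    congr 1
    field_simp
  set u := Real.log (1 - 1 / d)
  set v := Real.log (1 - -(1 / d))
  have h3 : meanLog d - Real.log d
      = (d + 1) ^ 2 / 2 * (-(1 / d) + (1 / d) ^ 2 / 2 + v)
        + (d - 1) ^ 2 / 2 * (1 / d + (1 / d) ^ 2 / 2 + u) - 1 / (2 * d ^ 2) := by
    rw [meanLog, logPrim, logPrim, logPrim, l1, l2]
    field_simp
    ring
  have e : (1 / d) ^ (2 + 1) / (1 - 1 / d) = 1 / (d ^ 2 * (d - 1)) := by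
    have : d - 1 ≠ 0 := by linarith
    field_simp
    rw [one_div, inv_pow, mul_inv_cancel₀ (by positivity)]
  rw [e] at h1 h2
  norm_num at h1 h2
  have h1' : |1 / d + (1 / d) ^ 2 / 2 + u| ≤ 1 / (d ^ 2 * (d - 1)) := by
    refine le_trans (le_of_eq ?_) (h1.trans (le_of_eq ?_))
    · congr 1
      simp
    · field_simp
  have h2' : |-(1 / d) + (1 / d) ^ 2 / 2 + v| ≤ 1 / (d ^ 2 * (d - 1)) := by
    refine le_trans (le_of_eq ?_) (h2.trans (le_of_eq ?_))
    · congr 1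
      simp [v]
    · field_simp
  rw [h3]
  have b1 : |(d + 1) ^ 2 / 2 * (-(1 / d) + (1 / d) ^ 2 / 2 + v)|
      ≤ (d + 1) ^ 2 / 2 * (1 / (d ^ 2 * (d - 1))) := by
    rw [abs_mul, abs_of_nonneg (by positivity : 0 ≤ (d + 1) ^ 2 / 2)]
    gcongr
  have b2 : |(d - 1) ^ 2 / 2 * (1 / d + (1 / d) ^ 2 / 2 + u)|
      ≤ (d - 1) ^ 2 / 2 * (1 / (d ^ 2 * (d - 1))) := by
    rw [abs_mul, abs_of_nonneg (by positivity : 0 ≤ (d - 1) ^ 2 / 2)]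
    gcongr
  have b3 : |1 / (2 * d ^ 2)| = 1 / (2 * d ^ 2) := abs_of_pos (by positivity)
  have b4 : (d + 1) ^ 2 / 2 * (1 / (d ^ 2 * (d - 1))) + (d - 1) ^ 2 / 2 * (1 / (d ^ 2 * (d - 1)))
      + 1 / (2 * d ^ 2) ≤ 6 / (d + 1) := by
    have hd1 : 0 < d - 1 := by linarith
    have : (d + 1) ^ 2 / 2 * (1 / (d ^ 2 * (d - 1))) + (d - 1) ^ 2 / 2 * (1 / (d ^ 2 * (d - 1)))
      + 1 / (2 * d ^ 2) = (2 * d ^ 2 + d + 1) / (2 * d ^ 2 * (d - 1)) := by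
      field_simp
      ring
    rw [this, div_le_div_iff₀ (by positivity) (by positivity)]
    obtain ⟨z, rfl⟩ : ∃ z, d = 2 + z := ⟨d - 2, by ring⟩
    have he : 0 ≤ z := by linarith
    have := mul_nonneg he (mul_nonneg he he)
    nlinarith [mul_nonneg he he]
  exact ((abs_sub _ _).trans (add_le_add (abs_add_le _ _) le_rfl)).trans (by linarith)

/-- For `d = 0` this is the estimate of `meanLog 0 = -3 / 2` against the junk value `log 0 = 0`. -/
theorem abs_meanLog_sub_log_le (d : ℤ) : |meanLog d - Real.log d| ≤ 6 / (|(d : ℝ)| + 1) := by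
  wlog hd : 0 ≤ d generalizing d
  · have := this (-d) (by omega)
    rwa [Int.cast_neg, meanLog_neg, Real.log_neg_eq_log, abs_neg] at this
  rw [abs_of_nonneg (by exact_mod_cast hd : (0 : ℝ) ≤ d)]
  obtain rfl | rfl | hd : d = 0 ∨ d = 1 ∨ 2 ≤ d := by omega
  · norm_num [meanLog, logPrim, Real.log_neg_eq_log]
  · have h1 := Real.log_two_gt_d9
    have h2 := Real.log_two_lt_d9
    norm_num [meanLog, logPrim]
    rw [abs_le]
    constructor <;> linarith
  · exact abs_meanLog_sub_log_le_of_two_le (by exact_mod_cast hd)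

theorem sum_range_inv_le (m : ℕ) : ∑ j ∈ Finset.range m, 1 / ((j : ℝ) + 1) ≤ 2 * √m := by
  induction m with
  | zero => simp
  | succ m ih =>
    rw [Finset.sum_range_succ]
    have h0 := Real.sqrt_nonneg (m : ℝ)
    have h1 : √(m : ℝ) ^ 2 = m := Real.sq_sqrt (by positivity)
    have h2 : √((m + 1 : ℕ) : ℝ) ^ 2 = m + 1 := by
      rw [Real.sq_sqrt (by positivity)]
      push_cast
      ring
    have h3 : 1 ≤ √((m + 1 : ℕ) : ℝ) := by
      rw [Real.one_le_sqrt]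
      push_cast
      linarith [(Nat.cast_nonneg m : (0 : ℝ) ≤ m)]
    have h4 : 1 / ((m : ℝ) + 1) ≤ 2 * (√((m + 1 : ℕ) : ℝ) - √(m : ℝ)) := by
      rw [← h2, div_le_iff₀ (by positivity)]
      set x := √((m + 1 : ℕ) : ℝ)
      set y := √(m : ℝ)
      have hxy : (x - y) * (x + y) = 1 := by nlinarith
      have hyx : y ≤ x := by nlinarith
      nlinarith [mul_nonneg (sub_nonneg.2 hyx) (sub_nonneg.2 h3),
        mul_nonneg (sub_nonneg.2 hyx) (sub_nonneg.2 hyx),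
        mul_nonneg (sub_nonneg.2 hyx) (mul_nonneg (by linarith : 0 ≤ x) (sub_nonneg.2 h3))]
    linarith

/-- Each distance from `s` occurs at most twice, and is less than `m`. -/
theorem sum_inv_abs_sub_le {X : Finset ℤ} {p : ℤ} {m : ℕ} (hX : X ⊆ Finset.Ico p (p + m))
    {s : ℤ} (hs : s ∈ X) : ∑ t ∈ X, 6 / (|((s - t : ℤ) : ℝ)| + 1) ≤ 24 * √m := by
  have h1 : X ⊆ (Finset.range m).image (fun j : ℕ => s + (j : ℤ))
      ∪ (Finset.range m).image (fun j : ℕ => s - (j : ℤ)) := by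
    intro t ht
    have h2 := Finset.mem_Ico.1 (hX ht)
    have h3 := Finset.mem_Ico.1 (hX hs)
    simp only [Finset.mem_union, Finset.mem_image, Finset.mem_range]
    rcases le_total s t with h | h
    · exact Or.inl ⟨(t - s).toNat, by omega, by omega⟩
    · exact Or.inr ⟨(s - t).toNat, by omega, by omega⟩
  have hpos : ∀ t : ℤ, 0 ≤ 6 / (|((s - t : ℤ) : ℝ)| + 1) := fun t => by positivity
  refine (Finset.sum_le_sum_of_subset_of_nonneg h1 fun t _ _ => hpos t).trans ?_
  have h4 := Finset.sum_union_inter (s₁ := (Finset.range m).image (fun j : ℕ => s + (j : ℤ)))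
    (s₂ := (Finset.range m).image (fun j : ℕ => s - (j : ℤ)))
    (f := fun t : ℤ => 6 / (|((s - t : ℤ) : ℝ)| + 1))
  have h5 : 0 ≤ ∑ t ∈ (Finset.range m).image (fun j : ℕ => s + (j : ℤ))
      ∩ (Finset.range m).image (fun j : ℕ => s - (j : ℤ)), 6 / (|((s - t : ℤ) : ℝ)| + 1) :=
    Finset.sum_nonneg fun t _ => hpos t
  rw [Finset.sum_image (fun i _ j _ h => by simpa using h),
    Finset.sum_image (fun i _ j _ h => by simpa using h)] at h4
  have h6 : ∀ j : ℕ, 6 / (|((s - (s + (j : ℤ)) : ℤ) : ℝ)| + 1) = 6 * (1 / ((j : ℝ) + 1)) := by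
    intro j
    push_cast
    rw [sub_add_cancel_left, abs_neg, Nat.abs_cast]
    ring
  have h7 : ∀ j : ℕ, 6 / (|((s - (s - (j : ℤ)) : ℤ) : ℝ)| + 1) = 6 * (1 / ((j : ℝ) + 1)) := by
    intro j
    push_cast
    rw [sub_sub_cancel, Nat.abs_cast]
    ring
  simp only [h6, h7, ← Finset.mul_sum] at h4
  have := sum_range_inv_le m
  linarith

/-- The bilinear form with kernel `meanLog` on functions on the finite set `X`. -/
noncomputable def meanForm (X : Finset ℤ) (f g : ℤ → ℝ) : ℝ :=
  ∑ s ∈ X, ∑ t ∈ X, f s * g t * meanLog ((s : ℝ) - t)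

/-- The indicator function of `U`. -/
noncomputable def ind (U : Finset ℤ) (t : ℤ) : ℝ := if t ∈ U then 1 else 0

theorem meanForm_ind {X U V : Finset ℤ} (hU : U ⊆ X) (hV : V ⊆ X) :
    meanForm X (ind U) (ind V) = ∑ s ∈ U, ∑ t ∈ V, meanLog ((s : ℝ) - t) := by
  have key : ∀ {U : Finset ℤ}, U ⊆ X → ∀ f : ℤ → ℝ,
      ∑ s ∈ X, ind U s * f s = ∑ s ∈ U, f s := by
    intro U hU f
    simp only [ind, ite_mul, one_mul, zero_mul]
    rw [Finset.sum_ite_mem, Finset.inter_eq_right.2 hU]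
  rw [meanForm, ← key hU]
  refine Finset.sum_congr rfl fun s _ => ?_
  rw [← key hV, Finset.mul_sum]
  exact Finset.sum_congr rfl fun t _ => by ring

theorem abs_logEnergy_sub_meanForm_le {X U : Finset ℤ} {p : ℤ} {m : ℕ}
    (hU : U ⊆ Finset.Ico p (p + m)) (hUX : U ⊆ X) :
    |logEnergy U - meanForm X (ind U) (ind U)| ≤ 24 * (m * √m) := by
  have hc : (U.card : ℝ) ≤ m := by
    have := Finset.card_le_card hU
    rw [Int.card_Ico] at this
    exact_mod_cast (by omega : U.card ≤ m)
  rw [meanForm_ind hUX hUX, logEnergy, ← Finset.sum_sub_distrib]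
  calc |∑ s ∈ U, (∑ t ∈ U, Real.log ((s : ℝ) - t) - ∑ t ∈ U, meanLog ((s : ℝ) - t))|
      ≤ ∑ s ∈ U, 24 * √m := by
        refine (Finset.abs_sum_le_sum_abs _ _).trans (Finset.sum_le_sum fun s hs => ?_)
        rw [← Finset.sum_sub_distrib]
        refine (Finset.abs_sum_le_sum_abs _ _).trans
          (le_trans (Finset.sum_le_sum fun t _ => ?_) (sum_inv_abs_sub_le hU hs))
        rw [abs_sub_comm, ← Int.cast_sub]
        exact abs_meanLog_sub_log_le _
    _ = U.card * (24 * √m) := by rw [Finset.sum_const, nsmul_eq_mul]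
    _ ≤ m * (24 * √m) := by gcongr
    _ = 24 * (m * √m) := by ring

theorem sum_meanLog_Ioc (u : ℝ) (q : ℤ) (y : ℕ) :
    ∑ t ∈ Finset.Ioc q (q + y), meanLog (u - t)
      = (logPrim (u - q) - logPrim (u - q - 1))
        - (logPrim (u - q - y) - logPrim (u - q - y - 1)) := by
  induction y with
  | zero => simp
  | succ y ih =>
    have : Finset.Ioc q (q + ((y + 1 : ℕ) : ℤ)) = insert (q + y + 1) (Finset.Ioc q (q + y)) := by
      ext t
      simp only [Finset.mem_Ioc, Finset.mem_insert]
      push_cast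
      omega
    rw [this, Finset.sum_insert (by simp), ih, meanLog]
    push_cast
    rw [show u - ((q : ℝ) + y + 1) + 1 = u - q - y by ring,
      show u - ((q : ℝ) + y + 1) - 1 = u - q - (y + 1) - 1 by ring,
      show u - ((q : ℝ) + y + 1) = u - q - (y + 1) by ring,
      show u - (q : ℝ) - y - 1 = u - q - (y + 1) by ring]
    ring

/-- Over pairs of intervals, the sum of the second differences `meanLog` telescopes. -/
theorem sum_sum_meanLog_Ioc (p q : ℤ) (x y : ℕ) :
    ∑ s ∈ Finset.Ioc p (p + x), ∑ t ∈ Finset.Ioc q (q + y), meanLog ((s : ℝ) - t)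
      = logPrim (p + x - q) + logPrim (p - q - y) - logPrim (p - q) - logPrim (p + x - q - y) := by
  induction x with
  | zero => simp
  | succ x ih =>
    have : Finset.Ioc p (p + ((x + 1 : ℕ) : ℤ)) = insert (p + x + 1) (Finset.Ioc p (p + x)) := by
      ext t
      simp only [Finset.mem_Ioc, Finset.mem_insert]
      push_cast
      omega
    rw [this, Finset.sum_insert (by simp), ih, sum_meanLog_Ioc]
    push_cast
    rw [show (p : ℝ) + x + 1 - q - 1 = p + x - q by ring,
      show (p : ℝ) + x + 1 - q - y - 1 = p + x - q - y by ring,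
      show (p : ℝ) + (x + 1) = p + x + 1 by ring]
    ring

/-! ### The bilinear form `inprod` on functions with derivative constant on cells -/

open MeasureTheory

theorem integral_log_abs_sub (x p q : ℝ) :
    ∫ y in p..q, Real.log |x - y|
      = ((x - p) * Real.log (x - p) - (x - p)) - ((x - q) * Real.log (x - q) - (x - q)) := by
  simp only [Real.log_abs]
  rw [intervalIntegral.integral_comp_sub_left (fun u => Real.log u) x, integral_log]
  ring

theorem intervalIntegrable_log_abs_sub (x p q : ℝ) :
    IntervalIntegrable (fun y => Real.log |x - y|) volume p q := by
  simp only [Real.log_abs]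
  have h : IntervalIntegrable Real.log volume (x - p) (x - q) :=
    intervalIntegral.intervalIntegrable_log'
  have := h.comp_sub_left x
  simpa using this

theorem hasDerivAt_logPrim {x : ℝ} (hx : x ≠ 0) :
    HasDerivAt logPrim (x * Real.log x - x) x := by
  have h1 : HasDerivAt (fun x : ℝ => x ^ 2 / 2) x x := by
    refine ((hasDerivAt_pow 2 x).div_const 2).congr_deriv ?_
    norm_num
  refine ((h1.mul (Real.hasDerivAt_log hx)).sub
    ((hasDerivAt_pow 2 x).const_mul (3 / 4 : ℝ))).congr_deriv ?_
  norm_num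
  field_simp
  ring

/-- The antiderivative `logPrim` need not be differentiated at `0`, where it is continuous. -/
theorem integral_mul_log_sub (p q a : ℝ) :
    ∫ x in p..q, ((x - a) * Real.log (x - a) - (x - a)) = logPrim (q - a) - logPrim (p - a) := by
  have hc : Continuous fun x : ℝ => x * Real.log x - x :=
    Real.continuous_mul_log.sub continuous_id
  rw [intervalIntegral.integral_comp_sub_right (fun x => x * Real.log x - x) a]
  exact integral_eq_of_hasDerivAt_off_countable logPrim
    (fun x => x * Real.log x - x)
    (Set.countable_singleton 0) continuous_logPrim.continuousOn
    (fun x hx => hasDerivAt_logPrim hx.2) (hc.intervalIntegrable _ _)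

/-- The function that is `w c` on the cell `((c - 1) / n, c / n]`, for `c ∈ X`, and `0`
elsewhere. -/
noncomputable def cellFun (n : ℕ) (X : Finset ℤ) (w : ℤ → ℝ) (t : ℝ) : ℝ :=
  ∑ c ∈ X, w c * (Set.Ioc (((c : ℝ) - 1) / n) (c / n)).indicator (fun _ => (1 : ℝ)) t

theorem integral_cellFun_mul {n : ℕ} {X : Finset ℤ} {w : ℤ → ℝ} {f u : ℝ → ℝ}
    (hf : f =ᵐ[volume] cellFun n X w)
    (hu : ∀ c : ℤ, IntervalIntegrable u volume (((c : ℝ) - 1) / n) (c / n)) :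
    ∫ y, f y * u y = ∑ c ∈ X, w c * ∫ y in (((c : ℝ) - 1) / n)..(c / n), u y := by
  have hle : ∀ c : ℤ, ((c : ℝ) - 1) / n ≤ c / n := fun c => by gcongr; linarith
  have h1 : ∫ y, f y * u y = ∫ y, ∑ c ∈ X,
      w c * (Set.Ioc (((c : ℝ) - 1) / n) (c / n)).indicator u y := by
    refine integral_congr_ae ?_
    filter_upwards [hf] with y hy
    rw [hy, cellFun, Finset.sum_mul]
    refine Finset.sum_congr rfl fun c _ => ?_
    by_cases h : y ∈ Set.Ioc (((c : ℝ) - 1) / n) (c / n)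
    · rw [Set.indicator_of_mem h, Set.indicator_of_mem h, mul_one]
    · rw [Set.indicator_of_notMem h, Set.indicator_of_notMem h, mul_zero, zero_mul]
  rw [h1, integral_finsetSum]
  · refine Finset.sum_congr rfl fun c _ => ?_
    rw [integral_const_mul, integral_indicator measurableSet_Ioc,
      intervalIntegral.integral_of_le (hle c)]
  · intro c _
    refine Integrable.const_mul ?_ _
    rw [integrable_indicator_iff measurableSet_Ioc]
    exact (intervalIntegrable_iff_integrableOn_Ioc_of_le (hle c)).1 (hu c)

theorem integral_integral_log_cells {n : ℕ} (hn : 0 < n) (c d : ℤ) :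
    ∫ x in (((c : ℝ) - 1) / n)..(c / n), ∫ y in (((d : ℝ) - 1) / n)..(d / n), Real.log |x - y|
      = (meanLog ((c : ℝ) - d) - Real.log n) / n ^ 2 := by
  have hn' : (n : ℝ) ≠ 0 := by positivity
  have hc : ∀ a : ℝ, Continuous fun x : ℝ => (x - a) * Real.log (x - a) - (x - a) := fun a =>
    (Real.continuous_mul_log.comp (continuous_id.sub continuous_const)).sub
      (continuous_id.sub continuous_const)
  simp only [integral_log_abs_sub]
  rw [intervalIntegral.integral_sub ((hc _).intervalIntegrable _ _)
    ((hc _).intervalIntegrable _ _), integral_mul_log_sub, integral_mul_log_sub, eq_div_iff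
    (pow_ne_zero 2 hn'), meanLog]
  have e1 := logPrim_div hn' ((c : ℝ) - d + 1)
  have e2 := logPrim_div hn' ((c : ℝ) - d - 1)
  have e3 := logPrim_div hn' ((c : ℝ) - d)
  rw [show (c : ℝ) / n - (d - 1) / n = (c - d + 1) / n by ring,
    show ((c : ℝ) - 1) / n - (d - 1) / n = (c - d) / n by ring,
    show (c : ℝ) / n - d / n = (c - d) / n by ring,
    show ((c : ℝ) - 1) / n - d / n = (c - d - 1) / n by ring]
  linear_combination e1 + e2 - 2 * e3

/-- If the derivative of `f` is the step function given by `w`, then `⟨f, f⟩` is the quadratic form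
`meanForm` at `w`, up to scaling, which accounts for `n ^ 2` and `log n`. -/
theorem inprod_eq {n : ℕ} (hn : 0 < n) {X : Finset ℤ} {w : ℤ → ℝ} {f : ℝ → ℝ}
    (hf : deriv f =ᵐ[volume] cellFun n X w) :
    inprod f f = (meanForm X w w - (∑ c ∈ X, w c) ^ 2 * Real.log n) / n ^ 2 := by
  have hc : ∀ a : ℝ, Continuous fun x : ℝ => (x - a) * Real.log (x - a) - (x - a) := fun a =>
    (Real.continuous_mul_log.comp (continuous_id.sub continuous_const)).sub
      (continuous_id.sub continuous_const)
  have hcd : ∀ d : ℤ, Continuous fun x : ℝ =>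
      ∫ y in (((d : ℝ) - 1) / n)..(d / n), Real.log |x - y| := by
    intro d
    simp only [integral_log_abs_sub]
    exact (hc _).sub (hc _)
  have h1 : ∀ x, ∫ y, deriv f x * deriv f y * Real.log |x - y|
      = deriv f x * ∑ d ∈ X, w d * ∫ y in (((d : ℝ) - 1) / n)..(d / n), Real.log |x - y| := by
    intro x
    simp only [mul_assoc]
    rw [integral_const_mul, integral_cellFun_mul hf fun c => intervalIntegrable_log_abs_sub _ _ _]
  rw [inprod]
  simp only [h1]
  have hcs : Continuous fun x : ℝ =>
      ∑ d ∈ X, w d * ∫ y in (((d : ℝ) - 1) / n)..(d / n), Real.log |x - y| :=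
    continuous_finsetSum _ fun d _ => continuous_const.mul (hcd d)
  rw [integral_cellFun_mul hf fun c => hcs.intervalIntegrable _ _]
  have h2 : ∀ c : ℤ, ∫ x in (((c : ℝ) - 1) / n)..(c / n),
      ∑ d ∈ X, w d * ∫ y in (((d : ℝ) - 1) / n)..(d / n), Real.log |x - y|
      = ∑ d ∈ X, w d * ((meanLog ((c : ℝ) - d) - Real.log n) / n ^ 2) := by
    intro c
    rw [intervalIntegral.integral_finsetSum fun d _ =>
      ((hcd d).const_mul (w d)).intervalIntegrable _ _]
    refine Finset.sum_congr rfl fun d _ => ?_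
    rw [intervalIntegral.integral_const_mul, integral_integral_log_cells hn]
  simp only [h2]
  rw [meanForm, pow_two (∑ c ∈ X, w c), Finset.sum_mul_sum, Finset.sum_mul,
    ← Finset.sum_sub_distrib, Finset.sum_div]
  refine Finset.sum_congr rfl fun c _ => ?_
  rw [Finset.sum_mul, ← Finset.sum_sub_distrib, Finset.sum_div, Finset.mul_sum]
  exact Finset.sum_congr rfl fun d _ => by ring

theorem countUpTo_add_one (S : Finset ℤ) (i : ℤ) :
    (countUpTo S (i + 1) : ℝ) - countUpTo S i = ind S (i + 1) := by
  have h1 : ∀ j, countUpTo S j = below S (j + 1) := by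
    intro j
    rw [countUpTo, below]
    congr 1
    ext s
    simp only [Finset.mem_filter]
    exact and_congr_right fun _ => (Int.lt_add_one_iff).symm
  rw [h1, h1, below_add_one S (i + 1), ind]
  push_cast
  ring

theorem hasDerivAt_normalizedCount {n : ℕ} (hn : 0 < n) (S : Finset ℤ) {t : ℝ} {c : ℤ}
    (h1 : ((c : ℝ) - 1) / n < t) (h2 : t < c / n) :
    HasDerivAt (normalizedCount n S) (ind S c) t := by
  have hn' : (0 : ℝ) < n := by exact_mod_cast hn
  have hloc : normalizedCount n S =ᶠ[nhds t] fun s =>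
      ((countUpTo S (c - 1) : ℝ) + (n * s - (c - 1)) * ind S c) / n := by
    filter_upwards [Ioo_mem_nhds h1 h2] with s hs
    have h3 : (c : ℝ) - 1 < n * s := by
      have := (div_lt_iff₀ hn').1 hs.1
      linarith
    have h4 : n * s < c := by
      have := (lt_div_iff₀ hn').1 hs.2
      linarith
    have h5 : ⌊(n : ℝ) * s⌋ = c - 1 := by
      rw [Int.floor_eq_iff]
      push_cast
      constructor <;> linarith
    have h6 := countUpTo_add_one S (c - 1)
    rw [sub_add_cancel] at h6
    rw [normalizedCount, Int.fract, h5, sub_add_cancel, h6]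
    push_cast
    ring
  refine HasDerivAt.congr_of_eventuallyEq ?_ hloc
  have h7 : HasDerivAt (fun s : ℝ => (n : ℝ) * s - (c - 1)) n t := by
    simpa using ((hasDerivAt_id t).const_mul (n : ℝ)).sub_const ((c : ℝ) - 1)
  refine (((h7.mul_const (ind S c)).const_add
    (countUpTo S (c - 1) : ℝ)).div_const (n : ℝ)).congr_deriv ?_
  field_simp

theorem cellFun_eq {n : ℕ} (hn : 0 < n) {X : Finset ℤ} {w : ℤ → ℝ} (hw : ∀ c, c ∉ X → w c = 0)
    {t : ℝ} {c : ℤ} (h1 : ((c : ℝ) - 1) / n < t) (h2 : t < c / n) : cellFun n X w t = w c := by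
  have hn' : (0 : ℝ) < n := by exact_mod_cast hn
  have hd : ∀ d : ℤ, t ∈ Set.Ioc (((d : ℝ) - 1) / n) (d / n) → d = c := by
    intro d hd
    rw [div_lt_iff₀ hn'] at h1
    rw [lt_div_iff₀ hn'] at h2
    have h3 := (div_lt_iff₀ hn').1 hd.1
    have h4 := (le_div_iff₀ hn').1 hd.2
    have h5 : (d : ℝ) < c + 1 := by linarith
    have h6 : (c : ℝ) < d + 1 := by linarith
    have h7 : d < c + 1 := by exact_mod_cast h5
    have h8 : c < d + 1 := by exact_mod_cast h6
    omega
  have h0 : ∀ d ∈ X, d ≠ c →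
      w d * (Set.Ioc (((d : ℝ) - 1) / n) (d / n)).indicator (fun _ => (1 : ℝ)) t = 0 := by
    intro d _ hdc
    rw [Set.indicator_of_notMem (fun h => hdc (hd d h)), mul_zero]
  rw [cellFun]
  by_cases hc : c ∈ X
  · rw [Finset.sum_eq_single_of_mem c hc h0, Set.indicator_of_mem (Set.mem_Ioc.2 ⟨h1, h2.le⟩),
      mul_one]
  · rw [hw c hc]
    exact Finset.sum_eq_zero fun d hdX => h0 d hdX fun h => hc (h ▸ hdX)

/-- Off a null set, the derivative of `A + J` is constant on cells of length `1 / n`. -/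
theorem deriv_normalizedCount_add_ae_eq {n : ℕ} (hn : 0 < n) {S X : Finset ℤ} {x y : ℕ}
    (hX : dents n S x y ⊆ X) {J : ℝ → ℝ} (hJ : IsHalfRamp ((x : ℝ) / n) ((y : ℝ) / n) J) :
    deriv (normalizedCount n S + J) =ᵐ[volume] cellFun n X fun c => ind S c
      + (ind (Finset.Ioc (-(x : ℤ)) 0) c + ind (Finset.Ioc (n : ℤ) (n + y)) c) / 2 := by
  have hn' : (0 : ℝ) < n := by exact_mod_cast hn
  have hnull : ∀ᵐ t : ℝ, t ∉ Set.range (fun z : ℤ => (z : ℝ) / n) :=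
    compl_mem_ae_iff.2 ((Set.countable_range _).measure_zero volume)
  filter_upwards [hJ.2, hnull] with t ht htn
  -- The point `t` is in the interior of the cell with number `c`.
  set c := ⌊(n : ℝ) * t⌋ + 1 with hc
  have f1 := Int.floor_le ((n : ℝ) * t)
  have f2 := Int.lt_floor_add_one ((n : ℝ) * t)
  have f3 : ((⌊(n : ℝ) * t⌋ : ℤ) : ℝ) ≠ n * t := by
    intro h
    exact htn ⟨⌊(n : ℝ) * t⌋, by simp only; rw [h]; field_simp⟩
  have c1 : (c : ℝ) - 1 < n * t := by
    rw [hc]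
    push_cast
    rw [add_sub_cancel_right]
    exact lt_of_le_of_ne f1 f3
  have c2 : n * t < c := by
    rw [hc]
    push_cast
    exact f2
  have h1 : ((c : ℝ) - 1) / n < t := by
    rw [div_lt_iff₀ hn']
    linarith
  have h2 : t < c / n := by
    rw [lt_div_iff₀ hn']
    linarith
  rw [cellFun_eq hn ?_ h1 h2, ((hasDerivAt_normalizedCount hn S h1 h2).add ht).deriv]
  · congr 1
    have e1 : t ∈ Set.Icc (-((x : ℝ) / n)) 0 ↔ c ∈ Finset.Ioc (-(x : ℤ)) 0 := by
      rw [Set.mem_Icc, Finset.mem_Ioc, ← neg_div, div_le_iff₀ hn']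
      constructor
      · rintro ⟨h3, h4⟩
        have h5 : ((-(x : ℤ) : ℤ) : ℝ) < c := by push_cast; linarith
        have h6 : (c : ℝ) < (1 : ℤ) := by push_cast; nlinarith
        have h5' := Int.cast_lt.1 h5
        have h6' := Int.cast_lt.1 h6
        omega
      · rintro ⟨h3, h4⟩
        have h5 : ((-(x : ℤ) : ℤ) : ℝ) ≤ (c - 1 : ℤ) := Int.cast_le.2 (by omega)
        have h6 : (c : ℝ) ≤ (0 : ℤ) := Int.cast_le.2 h4
        push_cast at h5 h6
        constructor
        · linarith
        · nlinarith
    have e2 : t ∈ Set.Icc 1 (1 + (y : ℝ) / n) ↔ c ∈ Finset.Ioc (n : ℤ) (n + y) := by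
      rw [Set.mem_Icc, Finset.mem_Ioc, show 1 + (y : ℝ) / n = (n + y) / n by field_simp,
        le_div_iff₀ hn']
      constructor
      · rintro ⟨h3, h4⟩
        have h5 : ((n : ℤ) : ℝ) < c := by push_cast; nlinarith
        have h6 : (c : ℝ) < ((n + y + 1 : ℤ) : ℝ) := by push_cast; nlinarith
        have h5' := Int.cast_lt.1 h5
        have h6' := Int.cast_lt.1 h6
        omega
      · rintro ⟨h3, h4⟩
        have h5 : ((n : ℤ) : ℝ) ≤ (c - 1 : ℤ) := Int.cast_le.2 (by omega)
        have h6 : (c : ℝ) ≤ ((n + y : ℤ) : ℝ) := Int.cast_le.2 h4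
        push_cast at h5 h6
        constructor
        · nlinarith
        · linarith
    by_cases hl : c ∈ Finset.Ioc (-(x : ℤ)) 0
    · have hr : c ∉ Finset.Ioc (n : ℤ) (n + y) := by
        rw [Finset.mem_Ioc] at *
        omega
      rw [Set.indicator_of_mem (Set.mem_union_left _ (e1.2 hl)), ind, ind, if_pos hl, if_neg hr]
      norm_num
    · by_cases hr : c ∈ Finset.Ioc (n : ℤ) (n + y)
      · rw [Set.indicator_of_mem (Set.mem_union_right _ (e2.2 hr)), ind, ind, if_neg hl, if_pos hr]
        norm_num
      · rw [Set.indicator_of_notMem, ind, ind, if_neg hl, if_neg hr]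
        · norm_num
        · rintro (h | h)
          · exact hl (e1.1 h)
          · exact hr (e2.1 h)
  · intro d hd
    have h3 : ¬ (d ∈ S ∨ (1 - (x : ℤ) ≤ d ∧ d ≤ 0) ∨ ((n : ℤ) + 1 ≤ d ∧ d ≤ n + y)) :=
      fun h => hd (hX (mem_dents.2 h))
    rw [not_or] at h3
    rw [ind, ind, ind, if_neg h3.1, if_neg (by rw [Finset.mem_Ioc]; omega),
      if_neg (by rw [Finset.mem_Ioc]; omega)]
    norm_num

/-! ### The constant term and the error estimate -/

theorem meanForm_comm (X : Finset ℤ) (f g : ℤ → ℝ) : meanForm X f g = meanForm X g f := by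
  rw [meanForm, meanForm, Finset.sum_comm]
  refine Finset.sum_congr rfl fun s _ => Finset.sum_congr rfl fun t _ => ?_
  rw [← meanLog_neg, neg_sub, mul_comm (f t)]

theorem meanForm_add_left (X : Finset ℤ) (f f' g : ℤ → ℝ) :
    meanForm X (f + f') g = meanForm X f g + meanForm X f' g := by
  simp only [meanForm, ← Finset.sum_add_distrib, Pi.add_apply]
  exact Finset.sum_congr rfl fun s _ => Finset.sum_congr rfl fun t _ => by ring

theorem meanForm_sub_left (X : Finset ℤ) (f f' g : ℤ → ℝ) :
    meanForm X (f - f') g = meanForm X f g - meanForm X f' g := by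
  simp only [meanForm, ← Finset.sum_sub_distrib, Pi.sub_apply]
  exact Finset.sum_congr rfl fun s _ => Finset.sum_congr rfl fun t _ => by ring

theorem meanForm_add_right (X : Finset ℤ) (f g g' : ℤ → ℝ) :
    meanForm X f (g + g') = meanForm X f g + meanForm X f g' := by
  rw [meanForm_comm, meanForm_add_left, meanForm_comm X g, meanForm_comm X g']

theorem meanForm_sub_right (X : Finset ℤ) (f g g' : ℤ → ℝ) :
    meanForm X f (g - g') = meanForm X f g - meanForm X f g' := by
  rw [meanForm_comm, meanForm_sub_left, meanForm_comm X g, meanForm_comm X g']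

/-- The parallelogram law. -/
theorem meanForm_parallelogram {X : Finset ℤ} {u l w : ℤ → ℝ}
    (hw : ∀ t, w t = (u t + l t) / 2) :
    meanForm X u u / 2 + meanForm X l l / 2
      = meanForm X w w + meanForm X (u - l) (u - l) / 4 := by
  simp only [meanForm, Finset.sum_div, ← Finset.sum_add_distrib, Pi.sub_apply, hw]
  exact Finset.sum_congr rfl fun s _ => Finset.sum_congr rfl fun t _ => by ring

/-- The mixed second difference of `logPrim` that gives the integral of `log |u - v|` over `u` and
`v` in the intervals of lengths `x` and `y` on either side of an interval of length `n`. -/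
noncomputable def crossPrim (n x y : ℝ) : ℝ :=
  logPrim (n + x + y) + logPrim n - logPrim (n + x) - logPrim (n + y)

theorem meanForm_left_left {X : Finset ℤ} {x y : ℕ} (hx : Finset.Ioc (-(x : ℤ)) 0 ⊆ X)
    (hy : Finset.Ioc (-(y : ℤ)) 0 ⊆ X) :
    meanForm X (ind (Finset.Ioc (-(x : ℤ)) 0)) (ind (Finset.Ioc (-(y : ℤ)) 0))
      = logPrim x + logPrim y - logPrim ((x : ℝ) - y) := by
  have h := sum_sum_meanLog_Ioc (-(x : ℤ)) (-(y : ℤ)) x y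
  rw [neg_add_cancel, neg_add_cancel] at h
  rw [meanForm_ind hx hy, h]
  push_cast
  rw [show -(x : ℝ) + x - -(y : ℝ) = y by ring, show -(x : ℝ) - -(y : ℝ) - y = -x by ring,
    show -(x : ℝ) - -(y : ℝ) = -(x - y) by ring, show (y : ℝ) - y = 0 by ring,
    logPrim_neg, logPrim_neg, logPrim_zero]
  ring

theorem meanForm_right_right {X : Finset ℤ} {n x y : ℕ}
    (hx : Finset.Ioc (n : ℤ) (n + x) ⊆ X) (hy : Finset.Ioc (n : ℤ) (n + y) ⊆ X) :
    meanForm X (ind (Finset.Ioc (n : ℤ) (n + x))) (ind (Finset.Ioc (n : ℤ) (n + y)))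
      = logPrim x + logPrim y - logPrim ((x : ℝ) - y) := by
  rw [meanForm_ind hx hy, sum_sum_meanLog_Ioc]
  push_cast
  rw [show (n : ℝ) + x - n = x by ring, show (n : ℝ) - n - y = -y by ring,
    show (n : ℝ) - n = 0 by ring, logPrim_neg, logPrim_zero]
  ring

theorem meanForm_left_right {X : Finset ℤ} {n x y : ℕ} (hx : Finset.Ioc (-(x : ℤ)) 0 ⊆ X)
    (hy : Finset.Ioc (n : ℤ) (n + y) ⊆ X) :
    meanForm X (ind (Finset.Ioc (-(x : ℤ)) 0)) (ind (Finset.Ioc (n : ℤ) (n + y)))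
      = crossPrim n x y := by
  have h := sum_sum_meanLog_Ioc (-(x : ℤ)) n x y
  rw [neg_add_cancel] at h
  rw [meanForm_ind hx hy, h, crossPrim]
  push_cast
  rw [show -(x : ℝ) + x - (n : ℝ) = -n by ring, show -(x : ℝ) - (n : ℝ) - y = -(n + x + y) by ring,
    show -(x : ℝ) - (n : ℝ) = -(n + x) by ring, show -(n : ℝ) - y = -(n + y) by ring,
    logPrim_neg, logPrim_neg, logPrim_neg, logPrim_neg]
  ring

theorem meanForm_Ico (m : ℕ) :
    meanForm (Finset.Ico 0 (m : ℤ)) (ind (Finset.Ico 0 (m : ℤ))) (ind (Finset.Ico 0 (m : ℤ)))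
      = 2 * logPrim m := by
  have h : Finset.Ico 0 (m : ℤ) = Finset.Ioc (-1) (-1 + (m : ℤ)) := by
    ext t
    simp only [Finset.mem_Ico, Finset.mem_Ioc]
    omega
  rw [meanForm_ind subset_rfl subset_rfl, h, sum_sum_meanLog_Ioc]
  push_cast
  rw [show (-1 : ℝ) + m - -1 = m by ring, show (-1 : ℝ) - -1 - m = -m by ring,
    show (-1 : ℝ) - -1 = 0 by ring, show (m : ℝ) - m = 0 by ring, logPrim_neg, logPrim_zero]
  ring

theorem card_dents {n : ℕ} {S : Finset ℤ} (hS : S ⊆ Finset.Icc 1 (n : ℤ)) (x y : ℕ) :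
    (dents n S x y).card = S.card + x + y := by
  rw [dents, Finset.card_union_of_disjoint, Finset.card_union_of_disjoint, Int.card_Icc,
    Int.card_Icc]
  · omega
  · rw [Finset.disjoint_left]
    intro t
    rw [Finset.mem_Icc, Finset.mem_Icc]
    omega
  · rw [Finset.disjoint_left]
    intro t ht
    have := Finset.mem_Icc.1 (hS ht)
    rw [Finset.mem_union, Finset.mem_Icc, Finset.mem_Icc]
    omega

theorem ind_dents {n : ℕ} {S : Finset ℤ} (hS : S ⊆ Finset.Icc 1 (n : ℤ)) (x y : ℕ) :
    ind (dents n S x y)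
      = ind S + (ind (Finset.Ioc (-(x : ℤ)) 0) + ind (Finset.Ioc (n : ℤ) (n + y))) := by
  funext t
  have h := @hS t
  rw [Finset.mem_Icc] at h
  simp only [Pi.add_apply, ind, mem_dents, Finset.mem_Ioc]
  by_cases h1 : t ∈ S
  · have := h h1
    rw [if_pos (Or.inl h1), if_pos h1, if_neg (by omega), if_neg (by omega)]
    norm_num
  · by_cases h2 : 1 - (x : ℤ) ≤ t ∧ t ≤ 0
    · rw [if_pos (Or.inr (Or.inl h2)), if_neg h1, if_pos (by omega), if_neg (by omega)]
      norm_num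
    · by_cases h3 : (n : ℤ) + 1 ≤ t ∧ t ≤ n + y
      · rw [if_pos (Or.inr (Or.inr h3)), if_neg h1, if_neg (by omega), if_pos (by omega)]
        norm_num
      · rw [if_neg (by tauto), if_neg h1, if_neg (by omega), if_neg (by omega)]
        norm_num

theorem sum_ind {X U : Finset ℤ} (hU : U ⊆ X) : ∑ t ∈ X, ind U t = U.card := by
  simp only [ind]
  rw [Finset.sum_ite_mem, Finset.inter_eq_right.2 hU]
  simp

/-- The positions in `S` cancel, and there remain intervals, of which the two on either side are
counted with opposite signs. -/
theorem meanForm_sub_dents {n : ℕ} {S X : Finset ℤ} (hS : S ⊆ Finset.Icc 1 (n : ℤ))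
    {x y x' y' : ℕ} (hX : dents n S x y ⊆ X) (hX' : dents n S x' y' ⊆ X) :
    meanForm X (ind (dents n S x y) - ind (dents n S x' y'))
        (ind (dents n S x y) - ind (dents n S x' y'))
      = 2 * logPrim ((x : ℝ) - x') + 2 * logPrim ((y : ℝ) - y')
        + 2 * (crossPrim n x y - crossPrim n x y' - crossPrim n x' y + crossPrim n x' y') := by
  have hd : ∀ {x y : ℕ}, dents n S x y ⊆ X → Finset.Ioc (-(x : ℤ)) 0 ⊆ X ∧
      Finset.Ioc (n : ℤ) (n + y) ⊆ X := by
    intro x y h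
    constructor <;> intro t ht <;> rw [Finset.mem_Ioc] at ht <;> refine h (mem_dents.2 ?_)
    · exact Or.inr (Or.inl (by omega))
    · exact Or.inr (Or.inr (by omega))
  obtain ⟨h1, h2⟩ := hd hX
  obtain ⟨h3, h4⟩ := hd hX'
  rw [ind_dents hS, ind_dents hS, add_sub_add_left_eq_sub]
  simp only [meanForm_add_left, meanForm_add_right, meanForm_sub_left, meanForm_sub_right]
  rw [meanForm_comm X (ind (Finset.Ioc (n : ℤ) (n + y))) (ind (Finset.Ioc (-(x : ℤ)) 0)),
    meanForm_comm X (ind (Finset.Ioc (n : ℤ) (n + y))) (ind (Finset.Ioc (-(x' : ℤ)) 0)),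
    meanForm_comm X (ind (Finset.Ioc (n : ℤ) (n + y'))) (ind (Finset.Ioc (-(x : ℤ)) 0)),
    meanForm_comm X (ind (Finset.Ioc (n : ℤ) (n + y'))) (ind (Finset.Ioc (-(x' : ℤ)) 0)),
    meanForm_comm X (ind (Finset.Ioc (-(x' : ℤ)) 0)) (ind (Finset.Ioc (-(x : ℤ)) 0)),
    meanForm_comm X (ind (Finset.Ioc (n : ℤ) (n + y'))) (ind (Finset.Ioc (n : ℤ) (n + y))),
    meanForm_left_left h1 h1, meanForm_left_left h1 h3, meanForm_left_left h3 h3,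
    meanForm_right_right h2 h2, meanForm_right_right h2 h4, meanForm_right_right h4 h4,
    meanForm_left_right h1 h2, meanForm_left_right h1 h4, meanForm_left_right h3 h2,
    meanForm_left_right h3 h4, sub_self, sub_self, sub_self, sub_self, logPrim_zero]
  ring

/-- The constant term of the asymptotics as a function of `a / n`, `c / n` and `k / n`.  The
second argument of `crossPrim` or the third vanishes in all but at most one of the four `crossPrim`
terms, so these are the interaction between the dents to the left and to the right of the positions,
with the sign of `(a - k) * (c - k)`; positive parts are used to make the continuity evident. -/
noncomputable def limitConst (p : ℝ × ℝ × ℝ) : ℝ :=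
  (logPrim (p.1 - p.2.2) + logPrim (p.2.1 - p.2.2)
    + (crossPrim 1 (max (p.2.2 - p.1) 0) (max (p.2.2 - p.2.1) 0)
      - crossPrim 1 (max (p.2.2 - p.1) 0) (max (p.2.1 - p.2.2) 0)
      - crossPrim 1 (max (p.1 - p.2.2) 0) (max (p.2.2 - p.2.1) 0)
      + crossPrim 1 (max (p.1 - p.2.2) 0) (max (p.2.1 - p.2.2) 0))) / 2
    - logPrim p.2.2 - logPrim (p.1 + p.2.1 - p.2.2)

theorem continuous_limitConst : Continuous limitConst := by
  unfold limitConst crossPrim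
  have h : ∀ {f : ℝ × ℝ × ℝ → ℝ}, Continuous f → Continuous fun p => logPrim (f p) :=
    fun hf => continuous_logPrim.comp hf
  fun_prop (disch := assumption)

theorem crossPrim_div {n : ℝ} (hn : n ≠ 0) (x y : ℝ) :
    n ^ 2 * crossPrim 1 (x / n) (y / n) = crossPrim n x y - x * y * Real.log n := by
  have e1 := logPrim_div hn (n + x + y)
  have e2 := logPrim_div hn n
  have e3 := logPrim_div hn (n + x)
  have e4 := logPrim_div hn (n + y)
  rw [crossPrim, crossPrim, show 1 + x / n + y / n = (n + x + y) / n by field_simp,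
    show 1 + x / n = (n + x) / n by field_simp, show 1 + y / n = (n + y) / n by field_simp,
    show logPrim 1 = logPrim (n / n) by rw [div_self hn]]
  linear_combination e1 + e2 - e3 - e4

/-- The values of `limitConst` at the ratios, in terms of integral lengths. -/
theorem limitConst_div {n : ℕ} (hn : 0 < n) (a c k : ℕ) (hk : k ≤ a + c) :
    (n : ℝ) ^ 2 * limitConst ((a : ℝ) / n, (c : ℝ) / n, (k : ℝ) / n)
      = (logPrim (((k - a : ℕ) : ℝ) - ((a - k : ℕ) : ℝ))
          + logPrim (((k - c : ℕ) : ℝ) - ((c - k : ℕ) : ℝ))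
          + (crossPrim n (k - a : ℕ) (k - c : ℕ) - crossPrim n (k - a : ℕ) (c - k : ℕ)
            - crossPrim n (a - k : ℕ) (k - c : ℕ) + crossPrim n (a - k : ℕ) (c - k : ℕ))) / 2
        - logPrim k - logPrim (a + c - k : ℕ) + ((a : ℝ) + c) ^ 2 / 4 * Real.log n := by
  have hn' : (n : ℝ) ≠ 0 := by positivity
  have hmax : ∀ x y : ℕ, max ((x : ℝ) / n - y / n) 0 = ((x - y : ℕ) : ℝ) / n := by
    intro x y
    rw [← sub_div]
    rcases le_total x y with h | h
    · rw [Nat.sub_eq_zero_of_le h, max_eq_right]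
      · simp
      · have : (x : ℝ) ≤ y := by exact_mod_cast h
        exact div_nonpos_of_nonpos_of_nonneg (by linarith) (by positivity)
    · rw [Nat.cast_sub h, max_eq_left]
      have : (y : ℝ) ≤ x := by exact_mod_cast h
      exact div_nonneg (by linarith) (by positivity)
  have hdiff : ∀ x y : ℕ, (((x - y : ℕ) : ℝ) - ((y - x : ℕ) : ℝ)) = x - y := by
    intro x y
    rcases le_total x y with h | h
    · rw [Nat.sub_eq_zero_of_le h, Nat.cast_sub h]
      simp
    · rw [Nat.sub_eq_zero_of_le h, Nat.cast_sub h]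
      simp
  have d1 := hdiff k a
  have d2 := hdiff k c
  have e1 := logPrim_div hn' ((k : ℝ) - a)
  have e2 := logPrim_div hn' ((k : ℝ) - c)
  have e3 := logPrim_div hn' (k : ℝ)
  have e4 := logPrim_div hn' ((a : ℝ) + c - k)
  have s1 : logPrim ((a : ℝ) / n - k / n) = logPrim (((k : ℝ) - a) / n) := by
    rw [← logPrim_neg]
    congr 1
    ring
  have s2 : logPrim ((c : ℝ) / n - k / n) = logPrim (((k : ℝ) - c) / n) := by
    rw [← logPrim_neg]
    congr 1
    ring
  have s4 : (a : ℝ) / n + c / n - k / n = (a + c - k) / n := by ring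
  have c1 := crossPrim_div hn' ((k - a : ℕ) : ℝ) ((k - c : ℕ) : ℝ)
  have c2 := crossPrim_div hn' ((k - a : ℕ) : ℝ) ((c - k : ℕ) : ℝ)
  have c3 := crossPrim_div hn' ((a - k : ℕ) : ℝ) ((k - c : ℕ) : ℝ)
  have c4 := crossPrim_div hn' ((a - k : ℕ) : ℝ) ((c - k : ℕ) : ℝ)
  rw [limitConst]
  simp only [hmax]
  rw [d1, d2, s1, s2, s4, Nat.cast_sub hk, Nat.cast_add]
  have hxy : (((k - a : ℕ) : ℝ) - ((a - k : ℕ) : ℝ)) * (((k - c : ℕ) : ℝ) - ((c - k : ℕ) : ℝ))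
      = ((k : ℝ) - a) * (k - c) := by rw [d1, d2]
  linear_combination (e1 + e2 + c1 - c2 - c3 + c4) / 2 - e3 - e4 - Real.log n / 2 * hxy

theorem abs_natCast_sub (x y : ℕ) : |(x : ℝ) - y| = ((y - x + (x - y) : ℕ) : ℝ) := by
  rcases le_total x y with h | h
  · rw [Nat.sub_eq_zero_of_le h, add_zero, Nat.cast_sub h, abs_sub_comm, abs_of_nonneg]
    simpa using h
  · rw [Nat.sub_eq_zero_of_le h, zero_add, Nat.cast_sub h, abs_of_nonneg]
    simpa using h

/-- The estimate with an explicit error term.  Here `m` bounds the lengths of the intervals that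
contain the dents on the two sides, and `m = n * (1 + ρL + ρR)`. -/
theorem abs_log_numTilings_sub_le {a b c k n : ℕ} (hb : 0 < b) (hk : 2 * k ≤ a + c)
    (hn : n = b + min k (min a c)) {S : Finset ℤ} (hS : S ⊆ Finset.Icc 1 (n : ℤ))
    (hSc : S.card = min k (min a c)) {J : ℝ → ℝ}
    (hJ : IsHalfRamp (|(a : ℝ) - k| / n) (|(c : ℝ) - k| / n) J) {m : ℕ}
    (hm : m = n + (k - a + (a - k)) + (k - c + (c - k))) :
    |Real.log (numTilings a b c k S) / (n : ℝ) ^ 2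
        - (inprod (normalizedCount n S + J) (normalizedCount n S + J)
          + limitConst ((a : ℝ) / n, (c : ℝ) / n, (k : ℝ) / n))|
      ≤ 48 * (m * √m) / (n : ℝ) ^ 2 := by
  have hn0 : 0 < n := by omega
  have hn' : (0 : ℝ) < (n : ℝ) ^ 2 := by positivity
  set U := dents n S (k - a) (k - c) with hU
  set L := dents n S (a - k) (c - k) with hL
  set X := U ∪ L with hX
  have hUX : U ⊆ X := Finset.subset_union_left
  have hLX : L ⊆ X := Finset.subset_union_right
  rw [abs_natCast_sub, abs_natCast_sub] at hJ
  set w : ℤ → ℝ := fun t => ind S t + (ind (Finset.Ioc (-((k - a + (a - k) : ℕ) : ℤ)) 0) t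
      + ind (Finset.Ioc (n : ℤ) (n + (k - c + (c - k) : ℕ))) t) / 2 with hw
  have hsub : dents n S (k - a + (a - k)) (k - c + (c - k)) ⊆ X := by
    intro t ht
    rw [mem_dents] at ht
    rw [hX, Finset.mem_union, hU, hL, mem_dents, mem_dents]
    rcases ht with h | h | h
    · exact Or.inl (Or.inl h)
    · rcases le_total a k with h' | h'
      · exact Or.inl (Or.inr (Or.inl (by omega)))
      · exact Or.inr (Or.inr (Or.inl (by omega)))
    · rcases le_total c k with h' | h'
      · exact Or.inl (Or.inr (Or.inr (by omega)))
      · exact Or.inr (Or.inr (Or.inr (by omega)))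
  have hwUL : ∀ t, w t = (ind U t + ind L t) / 2 := by
    intro t
    have hz : ind ∅ t = 0 := by simp [ind]
    rw [hU, hL, ind_dents hS, ind_dents hS, hw]
    simp only [Pi.add_apply]
    rcases le_total a k with h | h <;> rcases le_total c k with h' | h' <;>
      simp [Nat.sub_eq_zero_of_le h, Nat.sub_eq_zero_of_le h', hz] <;> ring
  have hsum : ∑ t ∈ X, w t = ((a : ℝ) + c) / 2 := by
    have h1 : U.card + L.card = a + c := by
      rw [hU, hL, card_dents hS, card_dents hS, hSc]
      omega
    simp only [hwUL]
    rw [← Finset.sum_div, Finset.sum_add_distrib, sum_ind hUX, sum_ind hLX]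
    congr 1
    exact_mod_cast h1
  have hin := inprod_eq hn0 (deriv_normalizedCount_add_ae_eq hn0 hsub hJ)
  rw [← hw, hsum] at hin
  have hpar := meanForm_parallelogram (X := X) hwUL
  rw [meanForm_sub_dents hS hUX hLX] at hpar
  have hK := limitConst_div hn0 a c k (by omega)
  have hT := log_numTilings hk hn hS hSc
  have eU := abs_logEnergy_sub_meanForm_le (p := 1 - ((k - a : ℕ) : ℤ)) (m := m)
    (fun t ht => by
      have h1 := mem_dents.1 ht
      have h2 := @hS t
      rw [Finset.mem_Icc] at h2
      rw [Finset.mem_Ico]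
      rcases h1 with h1 | h1 | h1
      · have := h2 h1
        omega
      · omega
      · omega) hUX
  have eL := abs_logEnergy_sub_meanForm_le (p := 1 - ((a - k : ℕ) : ℤ)) (m := m)
    (fun t ht => by
      have h1 := mem_dents.1 ht
      have h2 := @hS t
      rw [Finset.mem_Icc] at h2
      rw [Finset.mem_Ico]
      rcases h1 with h1 | h1 | h1
      · have := h2 h1
        omega
      · omega
      · omega) hLX
  have eI : ∀ j : ℕ, j ≤ m →
      |logEnergy (Finset.Ico 0 (j : ℤ)) - 2 * logPrim j| ≤ 24 * (m * √m) := by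
    intro j hj
    rw [← meanForm_Ico]
    refine abs_logEnergy_sub_meanForm_le (p := 0) (m := m) ?_ subset_rfl
    rw [zero_add]
    exact Finset.Ico_subset_Ico_right (by omega)
  have ek := eI k (by omega)
  have el := eI (a + c - k) (by omega)
  have key : Real.log (numTilings a b c k S) / (n : ℝ) ^ 2
        - (inprod (normalizedCount n S + J) (normalizedCount n S + J)
          + limitConst ((a : ℝ) / n, (c : ℝ) / n, (k : ℝ) / n))
      = ((logEnergy U - meanForm X (ind U) (ind U)) / 2
        + (logEnergy L - meanForm X (ind L) (ind L)) / 2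
        - (logEnergy (Finset.Ico 0 (k : ℤ)) - 2 * logPrim k) / 2
        - (logEnergy (Finset.Ico 0 ((a + c - k : ℕ) : ℤ))
          - 2 * logPrim (a + c - k : ℕ)) / 2) / (n : ℝ) ^ 2 := by
    -- The multiples of `log n` in `hin` and `hK` cancel here.
    rw [hin, hT, eq_div_iff hn'.ne']
    have : ∀ x y z : ℝ, (x / (n : ℝ) ^ 2 - (y / (n : ℝ) ^ 2 + z)) * (n : ℝ) ^ 2
        = x - y - (n : ℝ) ^ 2 * z := by
      intro x y z
      field_simp
      ring
    rw [this, hK]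
    linear_combination hpar
  rw [key, abs_div, abs_of_pos hn']
  gcongr
  rw [abs_le] at *
  constructor <;> linarith [eU.1, eU.2, eL.1, eL.2, ek.1, ek.2, el.1, el.2]

end LozengeTiling

theorem proposition3p1 :
    ∃ K : ℝ × ℝ × ℝ → ℝ, Continuous K ∧
      ∀ M : ℝ, ∀ ε : ℝ, 0 < ε → ∃ N : ℕ,
        ∀ a b c k n : ℕ, 0 < a → 0 < b → 0 < c → 2 * k ≤ a + c →
          n = b + min k (min a c) → N ≤ n →
        ∀ ρL ρR : ℝ, ρL = |(a : ℝ) - k| / n → ρR = |(c : ℝ) - k| / n → ρL ≤ M → ρR ≤ M →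
        ∀ S : Finset ℤ, S ⊆ Finset.Icc 1 (n : ℤ) → S.card = min k (min a c) →
        ∀ A : ℝ → ℝ, A = LozengeTiling.normalizedCount n S →
        ∀ J : ℝ → ℝ, LozengeTiling.IsHalfRamp ρL ρR J →
          |Real.log (LozengeTiling.numTilings a b c k S) / (n : ℝ) ^ 2
            - (LozengeTiling.inprod (A + J) (A + J)
                + K ((a : ℝ) / n, (c : ℝ) / n, (k : ℝ) / n))| ≤ ε := by
  refine ⟨LozengeTiling.limitConst, LozengeTiling.continuous_limitConst, fun M ε hε => ?_⟩
  set C := 1 + 2 * M with hC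
  -- The error is at most `48 * (C * n) ^ (3 / 2) / n ^ 2`, which is `48 * C ^ (3 / 2) / √n`.
  refine ⟨⌈(48 * (C * √C) / ε) ^ 2⌉₊, ?_⟩
  intro a b c k n _ hb _ hk hn hN ρL ρR hρL hρR hLM hRM S hS hSc A hA J hJ
  subst hA hρL hρR
  refine (LozengeTiling.abs_log_numTilings_sub_le hb hk hn hS hSc hJ rfl).trans ?_
  set m := n + (k - a + (a - k)) + (k - c + (c - k)) with hm
  have hn0 : (0 : ℝ) < n := by
    have : 0 < n := by omega
    exact_mod_cast this
  rw [div_le_iff₀ hn0] at hLM hRM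
  have hmC : (m : ℝ) ≤ C * n := by
    rw [hm, Nat.cast_add, Nat.cast_add, ← LozengeTiling.abs_natCast_sub,
      ← LozengeTiling.abs_natCast_sub]
    linarith
  have hC0 : 0 ≤ C := by
    have : 0 ≤ C * n := le_trans (Nat.cast_nonneg m) hmC
    exact nonneg_of_mul_nonneg_left this hn0
  have hs : √(n : ℝ) ^ 2 = n := Real.sq_sqrt hn0.le
  have hs0 : 0 < √(n : ℝ) := Real.sqrt_pos.2 hn0
  have h1 : (m : ℝ) * √m ≤ C * n * (√C * √n) := by
    rw [← Real.sqrt_mul hC0]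
    gcongr
  have h2 : 48 * (C * √C) / ε ≤ √n := by
    apply Real.le_sqrt_of_sq_le
    exact (Nat.le_ceil _).trans (by exact_mod_cast hN)
  rw [div_le_iff₀ hε] at h2
  rw [div_le_iff₀ (by positivity)]
  calc 48 * ((m : ℝ) * √m) ≤ 48 * (C * n * (√C * √n)) := by gcongr
    _ = 48 * (C * √C) * (n * √n) := by ring
    _ ≤ √n * ε * (n * √n) := by gcongr
    _ = ε * (√n ^ 2 * n) := by ring
    _ = ε * (n : ℝ) ^ 2 := by rw [hs]; ring
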